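/- Let $X$ be a locally compact metrizable space, $\phi:X\to X$ a homeomorphism, and let $\mathcal A=C_0(X)\times_\phi\mathbb Z_+$ be the semicrossed product: for a faithful $*$-representation $\rho$ of $C_0(X)$ on a Hilbert space $\mathcal H_0$, $\mathcal A$ is the norm closure in $\mathcal B(\mathcal H_0\otimes\ell^2(\mathbb Z_+))$ of the set of operators $\sum_{n\ge0}U^nf_n$ with $f_n\in C_0(X)$ and $\sum_n\|f_n\|<\infty$, where $U^nf(\xi\otimes e_k)=\rho(f\circ\phi^k)\xi\otimes e_{k+n}$. Let $E_n:\mathcal A\to C_0(X)$ be the $n$-th Fourier coefficient map, i.e. the continuous extension of $\sum_m U^mf_m\mapsto f_n$. An element $a$ of a Banach algebra $\mathcal B$ is compact if the map $x\mapsto axa$ on $\mathcal B$ is compact; $\mathcal B$ is hypocompact if every nonzero quotient of $\mathcal B$ by a closed two-sided ideal contains a nonzero compact element; the hypocompact radical $\mathcal B_{hc}$ is the largest closed two-sided ideal of $\mathcal B$ that is hypocompact as a Banach algebra. Let $X_p$ be the largest perfect (closed and dense in itself) subset of $X$. Put $X_0=X$; let $X_{\gamma+1}$ be the set of non-wandering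 points of the system $(X_\gamma,\phi|_{X_\gamma})$, i.e. of those points of $X_\gamma$ having no relatively open neighbourhood $W$ in $X_\gamma$ for which $\phi^{-1}(W),\phi^{-2}(W),\dots$ are pairwise disjoint; and let $X_\gamma=\bigcap_{\beta<\gamma}X_\beta$ for limit ordinals $\gamma$. Let $\gamma_0$ be the least ordinal with $X_{\gamma_0+1}=X_{\gamma_0}$. Then $\mathcal A$ has a hypocompact radical, and $$\mathcal A_{hc}=\{A\in\mathcal A:\ E_0(A)(x)=0\ \text{for all } x\in X_p,\ \text{and } E_n(A)(x)=0\ \text{for all } x\in X_{\gamma_0} \text{ and all } n\ge 0\}.$$ Moreover, $X_{\gamma_0}$ is the closure of the set of recurrent points of $(X,\phi)$, i.e. of the points $x$ such that for every neighbourhood $V$ of $x$ one has $\phi^n(x)\in V$ for infinitely many $n\in\mathbb N$. -/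

import Mathlib

open scoped ZeroAtInfty

universe u v

noncomputable section

/-! ### Hypocompact Banach algebras -/

namespace BanachAlg

/-- Elements of a (possibly non-unital) Banach algebra for which `x ↦ a * x * a` is a compact
operator. -/
def IsCompactElt {B : Type*} [Mul B] [Zero B] [TopologicalSpace B] (a : B) : Prop :=
  IsCompactOperator (fun x : B => a * x * a)

variable {B : Type*} [NonUnitalNormedRing B] [NormedSpace ℂ B]

/-- A subalgebra of a complex normed algebra, with the restricted norm. -/
instance subalgebraNormedSpace (J : NonUnitalSubalgebra ℂ B) : NormedSpace ℂ J where
  norm_smul_le c x := norm_smul_le c (x : B)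

/-- `J` is a closed two-sided ideal (in particular a linear subspace) of `B`. -/
structure IsClosedIdeal (J : NonUnitalSubalgebra ℂ B) : Prop where
  isClosed : IsClosed (J : Set B)
  mul_mem_left : ∀ a x : B, x ∈ J → a * x ∈ J
  mul_mem_right : ∀ a x : B, x ∈ J → x * a ∈ J

/-- The multiplication `[a] * [b] = [a * b]` of the quotient algebra `B ⧸ J`. -/
@[reducible] def quotientMul (J : NonUnitalSubalgebra ℂ B) (hJ : IsClosedIdeal J) :
    Mul (B ⧸ J.toSubmodule) where
  mul := Quotient.map₂ (· * ·) (by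
    intro a a' ha b b' hb
    have ha' : a - a' ∈ J := (Submodule.quotientRel_def J.toSubmodule).1 ha
    have hb' : b - b' ∈ J := (Submodule.quotientRel_def J.toSubmodule).1 hb
    refine (Submodule.quotientRel_def J.toSubmodule).2 ?_
    have h : a * b - a' * b' = (a - a') * b + a' * (b - b') := by
      rw [sub_mul, mul_sub]; abel
    change a * b - a' * b' ∈ J
    rw [h]
    exact add_mem (hJ.mul_mem_right _ _ ha') (hJ.mul_mem_left _ _ hb'))

theorem quotientMul_mk (J : NonUnitalSubalgebra ℂ B) (hJ : IsClosedIdeal J) (a b : B) :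
    (quotientMul J hJ).mul (J.toSubmodule.mkQ a) (J.toSubmodule.mkQ b) =
      J.toSubmodule.mkQ (a * b) := rfl

/-- `[a]` is a compact element of the quotient algebra `B ⧸ J` (with the quotient norm). -/
def IsCompactInQuotient (J : NonUnitalSubalgebra ℂ B) (hJ : IsClosedIdeal J)
    (a : B ⧸ J.toSubmodule) : Prop :=
  letI := quotientMul J hJ
  IsCompactElt a

variable (B) in
/-- `B` is hypocompact: each nonzero quotient of `B` by a closed ideal contains a nonzero compact
element. -/
def IsHypocompact : Prop :=
  ∀ (J : NonUnitalSubalgebra ℂ B) (hJ : IsClosedIdeal J), Nontrivial (B ⧸ J.toSubmodule) →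
    ∃ a : B ⧸ J.toSubmodule, a ≠ 0 ∧ IsCompactInQuotient J hJ a

/-- `R` is the hypocompact radical of `B`: the largest among the closed ideals of `B` that are
hypocompact as algebras. -/
def IsHypocompactRadical (R : NonUnitalSubalgebra ℂ B) : Prop :=
  IsGreatest {J : NonUnitalSubalgebra ℂ B | IsClosedIdeal J ∧ IsHypocompact J} R

end BanachAlg

/-! ### Wandering and recurrent points -/

namespace Dyn

variable {X : Type u} [TopologicalSpace X]

/-- The sets `φ⁻¹(W), φ⁻²(W), …` are pairwise disjoint. -/
def IsWandering (φ : X ≃ₜ X) (W : Set X) : Prop :=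
  ∀ m n : ℕ, 1 ≤ m → 1 ≤ n → m ≠ n → Disjoint (φ^[m] ⁻¹' W) (φ^[n] ⁻¹' W)

/-- The non-wandering points of the subsystem of `(X, φ)` on the `φ`-invariant set `Y`: the points
of `Y` none of whose relatively open neighbourhoods in `Y` is wandering. -/
def nonWandering (φ : X ≃ₜ X) (Y : Set X) : Set X :=
  {x | x ∈ Y ∧ ∀ V : Set X, IsOpen V → x ∈ V → ¬ IsWandering φ (V ∩ Y)}

/-- The transfinite sequence `X_0 = X`, `X_{γ+1} =` non-wandering points of `X_γ`, and
`X_γ = ⋂_{β < γ} X_β` for limit ordinals `γ`. -/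
def iterNonWandering (φ : X ≃ₜ X) (γ : Ordinal.{u}) : Set X :=
  Ordinal.limitRecOn γ Set.univ (fun _ Y => nonWandering φ Y)
    (fun γ _ Y => ⋂ (β : Ordinal.{u}) (h : β < γ), Y β h)

theorem iterNonWandering_zero (φ : X ≃ₜ X) : iterNonWandering φ 0 = Set.univ := by
  simp [iterNonWandering]

theorem iterNonWandering_succ (φ : X ≃ₜ X) (γ : Ordinal.{u}) :
    iterNonWandering φ (γ + 1) = nonWandering φ (iterNonWandering φ γ) := by
  simp [iterNonWandering]

theorem iterNonWandering_limit (φ : X ≃ₜ X) (γ : Ordinal.{u}) (hγ : Order.IsSuccLimit γ) :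
    iterNonWandering φ γ = ⋂ (β : Ordinal.{u}) (_ : β < γ), iterNonWandering φ β := by
  simp [iterNonWandering, Ordinal.limitRecOn_limit _ _ _ _ hγ]

theorem iterNonWandering_antitone (φ : X ≃ₜ X) : Antitone (iterNonWandering φ) := by
  intro β γ h
  induction γ using Ordinal.limitRecOn with
  | zero => rw [le_antisymm h zero_le]
  | add_one γ ih =>
    rcases h.lt_or_eq with h | rfl
    · rw [iterNonWandering_succ]
      exact fun x hx => ih (Order.lt_add_one_iff.1 h) hx.1
    · exact le_rfl
  | limit γ hγ ih =>
    rcases h.lt_or_eq with h | rfl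
    · rw [iterNonWandering_limit φ γ hγ]
      exact Set.biInter_subset_of_mem h
    · exact le_rfl

/-- The transfinite sequence becomes stationary. -/
theorem exists_iterNonWandering_stationary (φ : X ≃ₜ X) :
    ∃ γ : Ordinal.{u}, iterNonWandering φ (γ + 1) = iterNonWandering φ γ := by
  by_contra! hne
  refine not_injective_of_ordinal (iterNonWandering φ) (StrictAnti.injective ?_)
  intro β γ h
  have h1 : iterNonWandering φ γ ⊆ iterNonWandering φ (β + 1) :=
    iterNonWandering_antitone φ (Order.add_one_le_of_lt h)
  exact lt_of_le_of_lt h1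
    (lt_of_le_of_ne (iterNonWandering_antitone φ (Order.le_succ β)) (hne β))

/-- The ordinal `γ₀` at which the sequence `X_γ` stops. -/
def depth (φ : X ≃ₜ X) : Ordinal.{u} :=
  sInf {γ : Ordinal.{u} | iterNonWandering φ (γ + 1) = iterNonWandering φ γ}

/-- The recurrent points: `φ^n(x)` returns to each neighbourhood of `x` for infinitely many
`n ∈ ℕ`. -/
def recurrentPoints (φ : X ≃ₜ X) : Set X :=
  {x | MapClusterPt x Filter.atTop (fun n : ℕ => φ^[n] x)}

end Dyn

/-! ### The semicrossed product -/

namespace SemiCrossed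

variable {X : Type u} [TopologicalSpace X]

/-- `α_n(f) = f ∘ φ^n`. -/
def alpha (φ : X ≃ₜ X) (n : ℕ) (f : C₀(X, ℂ)) : C₀(X, ℂ) where
  toFun x := f (φ^[n] x)
  continuous_toFun := f.continuous.comp (φ.continuous.iterate n)
  zero_at_infty' := (zero_at_infty f).comp
    (Filter.Tendsto.iterate φ.isClosedEmbedding.tendsto_cocompact n)

variable {H₀ : Type v} [NormedAddCommGroup H₀] [InnerProductSpace ℂ H₀]

variable (H₀) in
/-- The Hilbert space `H₀ ⊗ ℓ²(ℤ₊)`, realised as the square summable sequences in `H₀`;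
`ξ ⊗ e_k` is `lp.single 2 k ξ`. -/
abbrev Amplified : Type v := lp (fun _ : ℕ => H₀) 2

/-- The sequence `(0, ξ_0, ξ_1, …)`. -/
def shiftSeq (ξ : ℕ → H₀) : ℕ → H₀
  | 0 => 0
  | k + 1 => ξ k

variable (H₀) in
/-- The unilateral shift `ξ ⊗ e_k ↦ ξ ⊗ e_{k+1}` as a linear map. -/
def shiftLin : Amplified H₀ →ₗ[ℂ] Amplified H₀ where
  toFun ξ := ⟨shiftSeq ξ, by
    have h := (lp.memℓp ξ).summable (by norm_num)
    exact memℓp_gen ((summable_nat_add_iff 1).1 h)⟩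
  map_add' ξ η := by
    apply lp.ext; funext k
    cases k with
    | zero => exact (add_zero (0 : H₀)).symm
    | succ k => rfl
  map_smul' c ξ := by
    apply lp.ext; funext k
    cases k with
    | zero => exact (smul_zero c).symm
    | succ k => rfl

variable (H₀) in
/-- The unilateral shift `ξ ⊗ e_k ↦ ξ ⊗ e_{k+1}`. -/
def shift : Amplified H₀ →L[ℂ] Amplified H₀ :=
  LinearMap.mkContinuous (shiftLin H₀) 1 (fun ξ => by
    have h2 : (0 : ℝ) < (2 : ENNReal).toReal := by norm_num
    have h := (lp.memℓp (shiftLin H₀ ξ)).summable h2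
    rw [one_mul]
    refine lp.norm_le_of_tsum_le h2 (norm_nonneg _) ?_
    rw [lp.norm_rpow_eq_tsum h2, h.tsum_eq_zero_add]
    have h0 : ‖shiftLin H₀ ξ 0‖ ^ (2 : ENNReal).toReal = 0 := by
      change ‖(0 : H₀)‖ ^ (2 : ENNReal).toReal = 0
      rw [norm_zero, Real.zero_rpow h2.ne']
    rw [h0, zero_add]
    exact le_rfl)

theorem shift_pow_apply_add (n k : ℕ) (ξ : Amplified H₀) : (shift H₀ ^ n) ξ (k + n) = ξ k := by
  induction n with
  | zero => rfl
  | succ n ih => rw [pow_succ']; exact ih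

theorem shift_pow_apply_lt (n k : ℕ) (h : k < n) (ξ : Amplified H₀) : (shift H₀ ^ n) ξ k = 0 := by
  induction n generalizing k with
  | zero => omega
  | succ n ih =>
    rw [pow_succ']
    cases k with
    | zero => rfl
    | succ k => exact ih k (by omega)

theorem norm_shift_le : ‖shift H₀‖ ≤ 1 := LinearMap.mkContinuous_norm_le _ zero_le_one _

variable [CompleteSpace H₀]

/-- The diagonal operator `ξ ⊗ e_k ↦ ρ(α_k(f)) ξ ⊗ e_k`. -/
def diag (φ : X ≃ₜ X) (ρ : C₀(X, ℂ) →⋆ₙₐ[ℂ] (H₀ →L[ℂ] H₀)) (f : C₀(X, ℂ)) :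
    Amplified H₀ →L[ℂ] Amplified H₀ :=
  lp.mapCLM 2 (fun k : ℕ => ρ (alpha φ k f)) (norm_nonneg f) (fun k => by
    refine (NonUnitalStarAlgHom.norm_apply_le ρ _).trans ?_
    exact (BoundedContinuousFunction.norm_le (norm_nonneg f)).2
      fun x => f.toBCF.norm_coe_le_norm (φ^[k] x))

/-- The operator `π(U^n f) : ξ ⊗ e_k ↦ ρ(α_k(f)) ξ ⊗ e_{k+n}`. -/
def monomial (φ : X ≃ₜ X) (ρ : C₀(X, ℂ) →⋆ₙₐ[ℂ] (H₀ →L[ℂ] H₀)) (n : ℕ) (f : C₀(X, ℂ)) :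
    Amplified H₀ →L[ℂ] Amplified H₀ :=
  shift H₀ ^ n * diag φ ρ f

theorem monomial_apply_add (φ : X ≃ₜ X) (ρ : C₀(X, ℂ) →⋆ₙₐ[ℂ] (H₀ →L[ℂ] H₀)) (n : ℕ)
    (f : C₀(X, ℂ)) (ξ : Amplified H₀) (k : ℕ) :
    monomial φ ρ n f ξ (k + n) = ρ (alpha φ k f) (ξ k) :=
  shift_pow_apply_add n k _

theorem monomial_apply_lt (φ : X ≃ₜ X) (ρ : C₀(X, ℂ) →⋆ₙₐ[ℂ] (H₀ →L[ℂ] H₀)) (n : ℕ)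
    (f : C₀(X, ℂ)) (ξ : Amplified H₀) (k : ℕ) (h : k < n) :
    monomial φ ρ n f ξ k = 0 :=
  shift_pow_apply_lt n k h _

/-- The covariance relation `U^m f · U^n g = U^{m+n} (α_n(f) g)`. -/
theorem monomial_mul (φ : X ≃ₜ X) (ρ : C₀(X, ℂ) →⋆ₙₐ[ℂ] (H₀ →L[ℂ] H₀)) (m n : ℕ)
    (f g : C₀(X, ℂ)) :
    monomial φ ρ m f * monomial φ ρ n g = monomial φ ρ (m + n) (alpha φ n f * g) := by
  ext ξ k
  change monomial φ ρ m f (monomial φ ρ n g ξ) k = _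
  rcases lt_or_ge k m with h | h
  · rw [monomial_apply_lt _ _ _ _ _ _ h, monomial_apply_lt _ _ _ _ _ _ (by omega)]
  obtain ⟨k, rfl⟩ := Nat.exists_eq_add_of_le' h
  rw [monomial_apply_add]
  rcases lt_or_ge k n with h | h
  · rw [monomial_apply_lt _ _ _ _ _ _ h, monomial_apply_lt _ _ _ _ _ _ (by omega), map_zero]
  obtain ⟨k, rfl⟩ := Nat.exists_eq_add_of_le' h
  rw [monomial_apply_add, show k + n + m = k + (m + n) by omega, monomial_apply_add]
  have e : alpha φ k (alpha φ n f * g) = alpha φ (k + n) f * alpha φ k g := by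
    ext x
    change f (φ^[n] (φ^[k] x)) * g (φ^[k] x) = f (φ^[k + n] x) * g (φ^[k] x)
    rw [add_comm k n, Function.iterate_add_apply]
  rw [e, map_mul]
  rfl

/-- The semicrossed product `C₀(X) ×_φ ℤ₊`: the norm closure, in the bounded operators on
`H₀ ⊗ ℓ²(ℤ₊)`, of the algebra generated by the operators `U^n f`. -/
def semicrossedProduct (φ : X ≃ₜ X) (ρ : C₀(X, ℂ) →⋆ₙₐ[ℂ] (H₀ →L[ℂ] H₀)) :
    NonUnitalSubalgebra ℂ (Amplified H₀ →L[ℂ] Amplified H₀) :=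
  (NonUnitalAlgebra.adjoin ℂ
    {T | ∃ (n : ℕ) (f : C₀(X, ℂ)), T = monomial φ ρ n f}).topologicalClosure

theorem monomial_mem (φ : X ≃ₜ X) (ρ : C₀(X, ℂ) →⋆ₙₐ[ℂ] (H₀ →L[ℂ] H₀)) (n : ℕ) (f : C₀(X, ℂ)) :
    monomial φ ρ n f ∈ semicrossedProduct φ ρ :=
  NonUnitalSubalgebra.le_topologicalClosure _ (NonUnitalAlgebra.subset_adjoin ℂ ⟨n, f, rfl⟩)

theorem monomial_add (φ : X ≃ₜ X) (ρ : C₀(X, ℂ) →⋆ₙₐ[ℂ] (H₀ →L[ℂ] H₀)) (n : ℕ)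
    (f g : C₀(X, ℂ)) : monomial φ ρ n (f + g) = monomial φ ρ n f + monomial φ ρ n g := by
  unfold monomial
  rw [← mul_add]
  congr 1
  ext ξ k
  change ρ (alpha φ k f + alpha φ k g) (ξ k) = _
  rw [map_add]
  rfl

theorem monomial_smul (φ : X ≃ₜ X) (ρ : C₀(X, ℂ) →⋆ₙₐ[ℂ] (H₀ →L[ℂ] H₀)) (n : ℕ) (c : ℂ)
    (f : C₀(X, ℂ)) : monomial φ ρ n (c • f) = c • monomial φ ρ n f := by
  unfold monomial
  rw [← mul_smul_comm]
  congr 1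
  ext ξ k
  change ρ (c • alpha φ k f) (ξ k) = _
  rw [map_smul]
  rfl

/-- The algebra generated by the operators `U^n f` is their linear span. -/
theorem adjoin_monomial_toSubmodule (φ : X ≃ₜ X) (ρ : C₀(X, ℂ) →⋆ₙₐ[ℂ] (H₀ →L[ℂ] H₀)) :
    (NonUnitalAlgebra.adjoin ℂ
      {T | ∃ (n : ℕ) (f : C₀(X, ℂ)), T = monomial φ ρ n f}).toSubmodule =
    Submodule.span ℂ {T | ∃ (n : ℕ) (f : C₀(X, ℂ)), T = monomial φ ρ n f} := by
  rw [NonUnitalAlgebra.adjoin_eq_span]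
  congr 1
  refine le_antisymm ?_ Subsemigroup.subset_closure
  refine (Subsemigroup.closure_le (S := ⟨{T | ∃ (n : ℕ) (f : C₀(X, ℂ)), T = monomial φ ρ n f},
    ?_⟩)).2 le_rfl
  rintro _ _ ⟨m, f, rfl⟩ ⟨n, g, rfl⟩
  exact ⟨_, _, monomial_mul φ ρ m n f g⟩

theorem norm_monomial_le (φ : X ≃ₜ X) (ρ : C₀(X, ℂ) →⋆ₙₐ[ℂ] (H₀ →L[ℂ] H₀)) (n : ℕ)
    (f : C₀(X, ℂ)) : ‖monomial φ ρ n f‖ ≤ ‖f‖ := by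
  have hs : ‖shift H₀ ^ n‖ ≤ 1 := by
    induction n with
    | zero => exact ContinuousLinearMap.norm_id_le
    | succ n ih =>
      rw [pow_succ]
      exact (norm_mul_le _ _).trans (mul_le_one₀ ih (norm_nonneg _) norm_shift_le)
  refine (norm_mul_le _ _).trans ?_
  calc _ ≤ 1 * ‖f‖ := by
        gcongr
        exact lp.norm_mapCLM_le _ _ _ _
    _ = ‖f‖ := one_mul _

/-- The representation `π (∑ U^n f_n) = ∑ π(U^n f_n)` of `ℓ¹(ℤ₊, C₀(X))`. -/
def ell1Rep (φ : X ≃ₜ X) (ρ : C₀(X, ℂ) →⋆ₙₐ[ℂ] (H₀ →L[ℂ] H₀)) (A : lp (fun _ : ℕ => C₀(X, ℂ)) 1) :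
    Amplified H₀ →L[ℂ] Amplified H₀ :=
  ∑' n, monomial φ ρ n (A n)

theorem hasSum_ell1Rep (φ : X ≃ₜ X) (ρ : C₀(X, ℂ) →⋆ₙₐ[ℂ] (H₀ →L[ℂ] H₀))
    (A : lp (fun _ : ℕ => C₀(X, ℂ)) 1) :
    HasSum (fun n => monomial φ ρ n (A n)) (ell1Rep φ ρ A) := by
  have h := (lp.memℓp A).summable (by norm_num)
  simp only [ENNReal.toReal_one, Real.rpow_one] at h
  exact (Summable.of_norm_bounded h fun n => norm_monomial_le φ ρ n (A n)).hasSum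

/-- The semicrossed product is the closure of the image of `ℓ¹(ℤ₊, C₀(X))`. -/
theorem coe_semicrossedProduct (φ : X ≃ₜ X) (ρ : C₀(X, ℂ) →⋆ₙₐ[ℂ] (H₀ →L[ℂ] H₀)) :
    (semicrossedProduct φ ρ : Set (Amplified H₀ →L[ℂ] Amplified H₀)) =
      closure (Set.range (ell1Rep φ ρ)) := by
  refine Set.Subset.antisymm (closure_mono ?_) (closure_minimal ?_
    (NonUnitalSubalgebra.isClosed_topologicalClosure _))
  · intro T hT
    have hT' : T ∈ Submodule.span ℂ {T | ∃ (n : ℕ) (f : C₀(X, ℂ)), T = monomial φ ρ n f} := by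
      rw [← adjoin_monomial_toSubmodule]; exact hT
    induction hT' using Submodule.span_induction with
    | mem x h =>
      obtain ⟨n, f, rfl⟩ := h
      refine ⟨lp.single 1 n f, (hasSum_ell1Rep φ ρ _).unique ?_⟩
      convert hasSum_single n ?_ using 1
      · rw [lp.single_apply_self]
      · intro m hm
        rw [lp.single_apply_ne _ _ _ hm]
        simpa using monomial_smul φ ρ m 0 0
    | zero =>
      refine ⟨0, (hasSum_ell1Rep φ ρ _).unique ?_⟩
      convert hasSum_zero using 2 with m
      simpa using monomial_smul φ ρ m 0 0
    | add x y hx hy ihx ihy =>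
      obtain ⟨A, rfl⟩ := ihx (by
        rw [← adjoin_monomial_toSubmodule] at hx; exact hx)
      obtain ⟨B, rfl⟩ := ihy (by
        rw [← adjoin_monomial_toSubmodule] at hy; exact hy)
      refine ⟨A + B, (hasSum_ell1Rep φ ρ _).unique ?_⟩
      convert (hasSum_ell1Rep φ ρ A).add (hasSum_ell1Rep φ ρ B) using 2 with m
      exact monomial_add φ ρ m _ _
    | smul c x hx ih =>
      obtain ⟨A, rfl⟩ := ih (by
        rw [← adjoin_monomial_toSubmodule] at hx; exact hx)
      refine ⟨c • A, (hasSum_ell1Rep φ ρ _).unique ?_⟩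
      convert (hasSum_ell1Rep φ ρ A).const_smul c using 2 with m
      exact monomial_smul φ ρ m _ _
  · rintro _ ⟨A, rfl⟩
    refine (NonUnitalSubalgebra.isClosed_topologicalClosure _).mem_of_tendsto (hasSum_ell1Rep φ ρ A)
      (Filter.Eventually.of_forall fun s => ?_)
    exact sum_mem fun n _ => monomial_mem φ ρ n _

/-! ### Fourier coefficients -/

variable (H₀) in
/-- The compression `T ↦ (ξ ↦` the `n`-th coordinate of `T (ξ ⊗ e_0))`. -/
def compression (n : ℕ) :
    (Amplified H₀ →L[ℂ] Amplified H₀) →L[ℂ] (H₀ →L[ℂ] H₀) :=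
  (ContinuousLinearMap.compL ℂ H₀ (Amplified H₀) H₀ (lp.evalCLM ℂ (fun _ : ℕ => H₀) 2 n)) ∘L
    ((ContinuousLinearMap.compL ℂ H₀ (Amplified H₀) (Amplified H₀)).flip
      (lp.singleContinuousLinearMap ℂ (fun _ : ℕ => H₀) 2 0))

theorem compression_monomial (φ : X ≃ₜ X) (ρ : C₀(X, ℂ) →⋆ₙₐ[ℂ] (H₀ →L[ℂ] H₀)) (n m : ℕ)
    (f : C₀(X, ℂ)) : compression H₀ n (monomial φ ρ m f) = if n = m then ρ f else 0 := by
  ext ξ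
  change monomial φ ρ m f (lp.single 2 0 ξ) n = _
  rcases lt_or_ge n m with h | h
  · rw [monomial_apply_lt _ _ _ _ _ _ h, if_neg h.ne]; rfl
  obtain ⟨k, rfl⟩ := Nat.exists_eq_add_of_le' h
  rw [monomial_apply_add]
  rcases Nat.eq_zero_or_pos k with rfl | hk
  · rw [lp.single_apply_self, if_pos (zero_add m)]; rfl
  · rw [lp.single_apply_ne _ _ _ hk.ne', if_neg (by omega), map_zero]; rfl

/-- A faithful representation of `C₀(X)` is isometric. -/
def repIsometry (ρ : C₀(X, ℂ) →⋆ₙₐ[ℂ] (H₀ →L[ℂ] H₀)) (hρ : Function.Injective ρ) :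
    C₀(X, ℂ) →ₗᵢ[ℂ] (H₀ →L[ℂ] H₀) where
  toFun := ρ
  map_add' := map_add ρ
  map_smul' := map_smul ρ
  norm_map' := NonUnitalStarAlgHom.norm_map ρ hρ

theorem compression_mem_range (φ : X ≃ₜ X) (ρ : C₀(X, ℂ) →⋆ₙₐ[ℂ] (H₀ →L[ℂ] H₀))
    (hρ : Function.Injective ρ) (n : ℕ) (A : semicrossedProduct φ ρ) :
    compression H₀ n A ∈ LinearMap.range (repIsometry ρ hρ).toLinearMap := by
  have hcl : IsClosed (LinearMap.range (repIsometry ρ hρ).toLinearMap : Set (H₀ →L[ℂ] H₀)) := by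
    rw [LinearMap.coe_range]
    exact (repIsometry ρ hρ).isometry.isClosedEmbedding.isClosed_range
  refine closure_minimal (?_ : _ ⊆ compression H₀ n ⁻¹' _)
    (hcl.preimage (compression H₀ n).continuous) A.2
  intro T hT
  have hT' : T ∈ Submodule.span ℂ {T | ∃ (n : ℕ) (f : C₀(X, ℂ)), T = monomial φ ρ n f} := by
    rw [← adjoin_monomial_toSubmodule]; exact hT
  refine (Submodule.span_le (p := (LinearMap.range (repIsometry ρ hρ).toLinearMap).comap
    (compression H₀ n).toLinearMap)).2 ?_ hT'
  rintro _ ⟨m, f, rfl⟩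
  rw [SetLike.mem_coe, Submodule.mem_comap]
  change compression H₀ n (monomial φ ρ m f) ∈ LinearMap.range (repIsometry ρ hρ).toLinearMap
  rw [compression_monomial]
  split_ifs
  · exact ⟨f, rfl⟩
  · exact zero_mem _

/-- The Fourier coefficient `E_n : C₀(X) ×_φ ℤ₊ → C₀(X)`: `E_n(A)` is the function `f` for which
`ρ(f)` is the `(n, 0)` entry of the operator matrix of `A`. -/
def fourierCoeff (φ : X ≃ₜ X) (ρ : C₀(X, ℂ) →⋆ₙₐ[ℂ] (H₀ →L[ℂ] H₀)) (hρ : Function.Injective ρ)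
    (n : ℕ) (A : semicrossedProduct φ ρ) : C₀(X, ℂ) :=
  (repIsometry ρ hρ).equivRange.symm ⟨compression H₀ n A, compression_mem_range φ ρ hρ n A⟩

theorem rep_fourierCoeff (φ : X ≃ₜ X) (ρ : C₀(X, ℂ) →⋆ₙₐ[ℂ] (H₀ →L[ℂ] H₀))
    (hρ : Function.Injective ρ) (n : ℕ) (A : semicrossedProduct φ ρ) :
    ρ (fourierCoeff φ ρ hρ n A) = compression H₀ n A :=
  congrArg Subtype.val ((repIsometry ρ hρ).equivRange.apply_symm_apply
    ⟨compression H₀ n A, compression_mem_range φ ρ hρ n A⟩)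

theorem continuous_fourierCoeff (φ : X ≃ₜ X) (ρ : C₀(X, ℂ) →⋆ₙₐ[ℂ] (H₀ →L[ℂ] H₀))
    (hρ : Function.Injective ρ) (n : ℕ) : Continuous (fourierCoeff φ ρ hρ n) :=
  (repIsometry ρ hρ).equivRange.symm.continuous.comp
    (((compression H₀ n).continuous.comp continuous_subtype_val).subtype_mk _)

/-- `E_n` is the continuous extension of `∑ U^m f_m ↦ f_n` from `ℓ¹(ℤ₊, C₀(X))`. -/
theorem fourierCoeff_ell1Rep (φ : X ≃ₜ X) (ρ : C₀(X, ℂ) →⋆ₙₐ[ℂ] (H₀ →L[ℂ] H₀))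
    (hρ : Function.Injective ρ) (n : ℕ) (A : lp (fun _ : ℕ => C₀(X, ℂ)) 1)
    (hA : ell1Rep φ ρ A ∈ semicrossedProduct φ ρ) :
    fourierCoeff φ ρ hρ n ⟨ell1Rep φ ρ A, hA⟩ = A n := by
  have h : HasSum (fun m => compression H₀ n (monomial φ ρ m (A m)))
      (compression H₀ n (ell1Rep φ ρ A)) :=
    (compression H₀ n).hasSum (hasSum_ell1Rep φ ρ A)
  have h' : HasSum (fun m => compression H₀ n (monomial φ ρ m (A m))) (ρ (A n)) := by
    convert hasSum_single n ?_ using 1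
    · rw [compression_monomial, if_pos rfl]
    · intro m hm
      rw [compression_monomial, if_neg hm.symm]
  exact hρ ((rep_fourierCoeff φ ρ hρ n ⟨ell1Rep φ ρ A, hA⟩).trans (h.unique h'))

end SemiCrossed

end

/-! ### Compact elements of quotient algebras. -/

noncomputable section

namespace BanachAlg

variable {B : Type*} [NonUnitalNormedRing B] [NormedSpace ℂ B]

/-! Let `Y` be the stationary set `X_γ₀`, `P` the perfect kernel, and `R` the ideal of elements
whose coefficients vanish as the theorem prescribes. Three facts give the result.

Recurrence: in `Y` every point is non-wandering for the restricted system, so points returning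
within `1/(k+1)` of themselves form a dense open subset of `Y`; by Baire, recurrent points are dense
in `Y` (`iterNonWandering_depth_eq_closure`).

`R` is an upper bound: suppose a hypocompact ideal `J` is not inside `R`. Then `J/(J ∩ R)` has a
nonzero compact element `[a]`. If some coefficient of `a` is nonzero on `Y`, its first nonvanishing
one is nonzero at a recurrent point, and the returns of that point yield bounded `y_i ∈ J` such that
the `a y_i a` have leading terms of increasing degree and size at least `ε`. Otherwise `E_0(a)` is
nonzero on `P`, hence bounded below at infinitely many points of `P`, and multipliers peaking at
different points separate the `a y_i a`. Both contradict compactness, because evaluated Fourier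
coefficients are contractive functionals that descend to the quotient.

`R` is hypocompact: let `J` be a closed ideal of `R` such that `R/J` has no nonzero compact element.
If `f` lives on a wandering piece of a stage `X_γ`, then `x ↦ (U^n f) x (U^n f)` with `n ≥ 1` is
zero modulo what `J` already contains, so `U^n f` lies in `J`; transfinite induction exhausts the
complement of `Y`. In degree zero, an isolated point outside `Y ∪ P` gives `x ↦ f x f` of rank at
most one modulo `J`, and Cantor–Bendixson leaves nothing outside `Y ∪ P`. Spectral synthesis, from
contractive Abel means, passes from the monomials `U^n E_n(A)` to `A`. -/

theorem isCompactInQuotient_of_rank_le_one (J : NonUnitalSubalgebra ℂ B) (hJ : IsClosedIdeal J)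
    (a c : B) (h : ∀ x : B, ∃ z : ℂ, a * x * a - z • c ∈ J) :
    IsCompactInQuotient J hJ (J.toSubmodule.mkQ a) := by
  let := quotientMul J hJ
  set L : Submodule ℂ (B ⧸ J.toSubmodule) := Submodule.span ℂ {J.toSubmodule.mkQ c}
  have : IsClosed (J.toSubmodule : Set B) := hJ.isClosed
  have hK : IsCompact (((↑) : L → B ⧸ J.toSubmodule) '' Metric.closedBall 0 (‖a‖ * ‖a‖)) :=
    (isCompact_closedBall _ _).image continuous_subtype_val
  -- A class of norm less than `1` has a representative of norm less than `1`, so its image lies in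
  -- the ball of radius `‖a‖ * ‖a‖` of the line spanned by `[c]`.
  refine ⟨_, hK, Filter.mem_of_superset (Metric.ball_mem_nhds 0 one_pos) fun q hq => ?_⟩
  rw [mem_ball_zero_iff] at hq
  obtain ⟨r, rfl, hr⟩ := Submodule.Quotient.norm_mk_lt q (sub_pos.2 hq)
  rw [add_sub_cancel] at hr
  obtain ⟨z, hz⟩ := h r
  have e : J.toSubmodule.mkQ (a * r * a) = z • J.toSubmodule.mkQ c := by
    rw [← map_smul]
    exact (Submodule.Quotient.eq _).2 hz
  refine ⟨⟨J.toSubmodule.mkQ (a * r * a), ?_⟩, ?_, rfl⟩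
  · rw [e]
    exact Submodule.smul_mem _ _ (Submodule.mem_span_singleton_self _)
  · rw [mem_closedBall_zero_iff]
    calc ‖J.toSubmodule.mkQ (a * r * a)‖ ≤ ‖a * r * a‖ := Submodule.Quotient.norm_mk_le _ _
      _ ≤ ‖a‖ * ‖r‖ * ‖a‖ := (norm_mul_le _ _).trans (by gcongr; exact norm_mul_le _ _)
      _ ≤ ‖a‖ * 1 * ‖a‖ := by gcongr
      _ = ‖a‖ * ‖a‖ := by rw [mul_one]

/-- Multiplication by a compact element maps a bounded sequence to a sequence without a uniformly
separated subsequence. -/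
theorem IsCompactInQuotient.exists_norm_sub_lt {J : NonUnitalSubalgebra ℂ B}
    [SMulCommClass ℂ B B] [IsScalarTower ℂ B B]
    {hJ : IsClosedIdeal J} {a : B} (h : IsCompactInQuotient J hJ (J.toSubmodule.mkQ a))
    (x : ℕ → B) (M : ℝ) (hx : ∀ i, ‖x i‖ ≤ M) {ε : ℝ} (hε : 0 < ε) :
    ∃ i j, i < j ∧ ‖J.toSubmodule.mkQ (a * x i * a - a * x j * a)‖ < ε := by
  let := quotientMul J hJ
  obtain ⟨K, hK, hnhds⟩ := h
  obtain ⟨δ, hδ, hball⟩ := Metric.mem_nhds_iff.1 hnhds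
  have hM : 0 < |M| + 1 := by positivity
  -- This factor brings the whole sequence into the ball that is mapped into `K`.
  set t : ℝ := δ / (|M| + 1) with ht
  have ht0 : 0 < t := by positivity
  have hmem : ∀ i, J.toSubmodule.mkQ ((t : ℂ) • (a * x i * a)) ∈ K := by
    intro i
    have h1 : J.toSubmodule.mkQ ((t : ℂ) • x i) ∈ Metric.ball (0 : B ⧸ J.toSubmodule) δ := by
      rw [mem_ball_zero_iff]
      refine (Submodule.Quotient.norm_mk_le _ _).trans_lt ?_
      rw [norm_smul, Complex.norm_real, Real.norm_of_nonneg ht0.le]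
      calc t * ‖x i‖ < t * (|M| + 1) :=
            mul_lt_mul_of_pos_left (((hx i).trans (le_abs_self M)).trans_lt (lt_add_one _)) ht0
        _ = δ := by rw [ht]; field_simp
    have h2 := hball h1
    have h3 : (t : ℂ) • (a * x i * a) = a * ((t : ℂ) • x i) * a := by
      rw [mul_smul_comm, smul_mul_assoc]
    rw [h3]
    exact h2
  obtain ⟨y, -, ψ, hψ, hlim⟩ := hK.tendsto_subseq hmem
  obtain ⟨N, hN⟩ := Metric.cauchySeq_iff.1 hlim.cauchySeq (t * ε) (by positivity)
  refine ⟨ψ N, ψ (N + 1), hψ N.lt_succ_self, ?_⟩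
  have h4 := hN N le_rfl (N + 1) (Nat.le_succ N)
  simp only [Function.comp_apply] at h4
  rw [dist_eq_norm, ← map_sub, ← smul_sub, map_smul, norm_smul, Complex.norm_real,
    Real.norm_of_nonneg ht0.le] at h4
  exact lt_of_mul_lt_mul_left h4 ht0.le

/-- The functional is constant on cosets, so every representative bounds it. This supplies lower
bounds for quotient norms from Fourier coefficients. -/
theorem norm_apply_le_norm_mkQ (J : NonUnitalSubalgebra ℂ B) (F : B →L[ℂ] ℂ)
    (hF : ∀ x, ‖F x‖ ≤ ‖x‖) (hJ : ∀ x ∈ J, F x = 0) (x : B) :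
    ‖F x‖ ≤ ‖J.toSubmodule.mkQ x‖ := by
  refine le_of_forall_pos_lt_add fun ε hε => ?_
  obtain ⟨m, hm, hlt⟩ := Submodule.Quotient.norm_mk_lt (J.toSubmodule.mkQ x) hε
  have h1 : m - x ∈ J := (Submodule.Quotient.eq _).1 hm
  have h2 : F m = F x := by
    rw [← sub_eq_zero, ← map_sub]
    exact hJ _ h1
  rw [← h2]
  exact (hF m).trans_lt hlt

end BanachAlg

/-! ### The non-wandering filtration and recurrence. -/

namespace Dyn

open Filter Topology

variable {X : Type u} [TopologicalSpace X]

/-- Two preimages meet exactly when some point of `W` returns to `W`. Since the exponents start at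
`1`, a return of `x` is witnessed by the point `φ.symm x`. -/
theorem isWandering_iff (φ : X ≃ₜ X) (W : Set X) :
    IsWandering φ W ↔ ∀ n : ℕ, 1 ≤ n → ∀ x ∈ W, φ^[n] x ∉ W := by
  constructor
  · intro h n hn x hx hnx
    have h1 : φ.symm x ∈ φ^[1] ⁻¹' W := by simpa using hx
    have h2 : φ.symm x ∈ φ^[n + 1] ⁻¹' W := by simpa [Function.iterate_succ_apply] using hnx
    exact Set.disjoint_left.1 (h 1 (n + 1) le_rfl (by omega) (by omega)) h1 h2
  · intro h m n hm hn hmn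
    wlog hlt : m < n generalizing m n
    · exact (this n m hn hm hmn.symm (by omega)).symm
    refine Set.disjoint_left.2 fun x hx hx' => h (n - m) (by omega) _ hx ?_
    rw [← Function.iterate_add_apply, Nat.sub_add_cancel hlt.le]
    exact hx'

theorem isClosed_nonWandering (φ : X ≃ₜ X) {Y : Set X} (hY : IsClosed Y) :
    IsClosed (nonWandering φ Y) := by
  have h : nonWandering φ Y = Y ∩ (⋃₀ {V | IsOpen V ∧ IsWandering φ (V ∩ Y)})ᶜ := by
    ext x
    simp only [nonWandering, Set.mem_ofPred_eq, Set.mem_inter_iff, Set.mem_compl_iff,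
      Set.mem_sUnion, not_exists, not_and]
    exact and_congr_right fun _ => ⟨fun h V hV hx => h V hV.1 hx hV.2,
      fun h V hV hx hw => h V ⟨hV, hw⟩ hx⟩
  rw [h]
  exact hY.inter (isOpen_sUnion fun V hV => hV.1).isClosed_compl

theorem isClosed_iterNonWandering (φ : X ≃ₜ X) (γ : Ordinal.{u}) :
    IsClosed (iterNonWandering φ γ) := by
  induction γ using Ordinal.limitRecOn with
  | zero => rw [iterNonWandering_zero]; exact isClosed_univ
  | add_one γ ih => rw [iterNonWandering_succ]; exact isClosed_nonWandering φ ih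
  | limit γ hγ ih =>
    rw [iterNonWandering_limit φ γ hγ]
    exact isClosed_biInter fun β hβ => ih β hβ

theorem apply_mem_nonWandering (φ : X ≃ₜ X) {Y : Set X} (hY : ∀ x ∈ Y, φ x ∈ Y) {x : X}
    (hx : x ∈ nonWandering φ Y) : φ x ∈ nonWandering φ Y := by
  refine ⟨hY x hx.1, fun V hV hxV hw => hx.2 (φ ⁻¹' V) (hV.preimage φ.continuous) hxV ?_⟩
  rw [isWandering_iff] at hw ⊢
  rintro n hn y ⟨hyV, hyY⟩ ⟨hzV, hzY⟩
  refine hw n hn (φ y) ⟨hyV, hY y hyY⟩ ?_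
  rw [← Function.iterate_succ_apply, Function.iterate_succ_apply']
  exact ⟨hzV, hY _ hzY⟩

theorem apply_mem_iterNonWandering (φ : X ≃ₜ X) (γ : Ordinal.{u}) :
    ∀ x ∈ iterNonWandering φ γ, φ x ∈ iterNonWandering φ γ := by
  induction γ using Ordinal.limitRecOn with
  | zero => simp [iterNonWandering_zero]
  | add_one γ ih =>
    rw [iterNonWandering_succ]
    exact fun x hx => apply_mem_nonWandering φ ih hx
  | limit γ hγ ih =>
    rw [iterNonWandering_limit φ γ hγ]
    intro x hx
    simp only [Set.mem_iInter] at hx ⊢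
    exact fun β hβ => ih β hβ x (hx β hβ)

theorem iterate_mem_iterNonWandering (φ : X ≃ₜ X) (γ : Ordinal.{u}) (n : ℕ) {x : X}
    (hx : x ∈ iterNonWandering φ γ) : φ^[n] x ∈ iterNonWandering φ γ := by
  induction n with
  | zero => exact hx
  | succ n ih =>
    rw [Function.iterate_succ_apply']
    exact apply_mem_iterNonWandering φ γ _ ih

theorem iterNonWandering_depth_add_one (φ : X ≃ₜ X) :
    iterNonWandering φ (depth φ + 1) = iterNonWandering φ (depth φ) :=
  csInf_mem (exists_iterNonWandering_stationary φ)

/-- Every stage is forward invariant, so a recurrent point of a stage makes its returns inside that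
stage and is non-wandering there. -/
theorem recurrentPoints_subset_iterNonWandering (φ : X ≃ₜ X) (γ : Ordinal.{u}) :
    recurrentPoints φ ⊆ iterNonWandering φ γ := by
  induction γ using Ordinal.limitRecOn with
  | zero => simp [iterNonWandering_zero]
  | add_one γ ih =>
    rw [iterNonWandering_succ]
    intro x hx
    refine ⟨ih hx, fun V hV hxV hw => ?_⟩
    obtain ⟨n, hn, hnV⟩ :=
      ((mapClusterPt_iff_frequently.1 hx V (hV.mem_nhds hxV)).and_eventually
        (eventually_ge_atTop 1)).exists.imp fun n h => And.symm h
    exact (isWandering_iff φ _).1 hw n hn x ⟨hxV, ih hx⟩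
      ⟨hnV, iterate_mem_iterNonWandering φ γ n (ih hx)⟩
  | limit γ hγ ih =>
    rw [iterNonWandering_limit φ γ hγ]
    exact fun x hx => Set.mem_iInter₂.2 fun β hβ => ih β hβ hx

/-- A point that returns arbitrarily close to itself is recurrent. -/
theorem mem_recurrentPoints_of_returns {X : Type u} [MetricSpace X] (φ : X ≃ₜ X) {x : X}
    (h : ∀ k : ℕ, ∃ n, 1 ≤ n ∧ dist (φ^[n] x) x < 1 / (k + 1 : ℝ)) : x ∈ recurrentPoints φ := by
  have hret : ∀ ε > 0, ∃ n, 1 ≤ n ∧ dist (φ^[n] x) x < ε := by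
    intro ε hε
    obtain ⟨k, hk⟩ := exists_nat_one_div_lt hε
    obtain ⟨n, hn, hd⟩ := h k
    exact ⟨n, hn, hd.trans hk⟩
  refine mapClusterPt_iff_frequently.2 fun V hV => frequently_atTop.2 fun N => ?_
  -- Close returns must be made late. A periodic point returns at multiples of its period; otherwise
  -- the first `N` iterates stay at a positive distance from `x`, and a closer return comes after
  -- time `N`.
  by_cases hper : ∃ p, 1 ≤ p ∧ φ^[p] x = x
  · obtain ⟨p, hp, hpx⟩ := hper
    refine ⟨N * p, Nat.le_mul_of_pos_right N hp, ?_⟩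
    rw [mul_comm, Function.iterate_mul, Function.iterate_fixed hpx]
    exact mem_of_mem_nhds hV
  · push Not at hper
    obtain ⟨ε, hε, hεV⟩ := Metric.mem_nhds_iff.1 hV
    have hev : ∀ᶠ δ in 𝓝[>] (0 : ℝ), ∀ n ∈ Finset.Icc 1 N, δ < dist (φ^[n] x) x := by
      refine (Finset.eventually_all _).2 fun n hn => ?_
      exact nhdsWithin_le_nhds (Iio_mem_nhds (dist_pos.2 (hper n (Finset.mem_Icc.1 hn).1)))
    obtain ⟨δ, hδ, hδ0⟩ := (hev.and self_mem_nhdsWithin).exists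
    obtain ⟨n, hn, hd⟩ := hret (min ε δ) (lt_min hε hδ0)
    refine ⟨n, ?_, hεV (hd.trans_le (min_le_left _ _))⟩
    by_contra hlt
    exact absurd (hδ n (Finset.mem_Icc.2 ⟨hn, by omega⟩)) (not_lt.2 (hd.le.trans (min_le_right _ _)))

/-- Baire's theorem on the closed, hence locally compact, stationary set: non-wandering gives
density of the points with a `1/(k+1)`-close return, and a point with such returns for all `k` is
recurrent. -/
theorem iterNonWandering_depth_eq_closure [LocallyCompactSpace X]
    [TopologicalSpace.MetrizableSpace X] (φ : X ≃ₜ X) :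
    iterNonWandering φ (depth φ) = closure (recurrentPoints φ) := by
  refine Set.Subset.antisymm ?_ (closure_minimal (recurrentPoints_subset_iterNonWandering φ _)
    (isClosed_iterNonWandering φ _))
  let := TopologicalSpace.metrizableSpaceMetric X
  set Y := iterNonWandering φ (depth φ) with hY
  have hcl : IsClosed Y := isClosed_iterNonWandering φ _
  have : LocallyCompactSpace Y := hcl.isClosedEmbedding_subtypeVal.locallyCompactSpace
  set U : ℕ → Set Y := fun k => {y | ∃ n, 1 ≤ n ∧ dist (φ^[n] (y : X)) y < 1 / (k + 1 : ℝ)}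
  have hUo : ∀ k, IsOpen (U k) := by
    intro k
    have : U k = ⋃ n : ℕ, ⋃ _ : 1 ≤ n, {y : Y | dist (φ^[n] (y : X)) y < 1 / (k + 1 : ℝ)} := by
      ext y; simp [U]
    rw [this]
    refine isOpen_iUnion fun n => isOpen_iUnion fun _ => isOpen_lt ?_ continuous_const
    exact ((φ.continuous.iterate n).comp continuous_subtype_val).dist continuous_subtype_val
  have hUd : ∀ k, Dense (U k) := by
    intro k
    refine Metric.dense_iff.2 fun y ε hε => ?_
    have hk : (0 : ℝ) < 1 / (k + 1 : ℝ) := by positivity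
    set r := min ε (1 / (k + 1 : ℝ) / 2)
    have hr : 0 < r := lt_min hε (by positivity)
    have hy : (y : X) ∈ nonWandering φ Y := by
      have h1 : nonWandering φ Y = Y := by
        rw [hY, ← iterNonWandering_succ, iterNonWandering_depth_add_one]
      exact h1.ge y.2
    have hnw := hy.2 (Metric.ball y r) Metric.isOpen_ball (Metric.mem_ball_self hr)
    rw [isWandering_iff] at hnw
    push Not at hnw
    obtain ⟨n, hn, z, ⟨hzb, hzY⟩, hz'b, -⟩ := hnw
    refine ⟨⟨z, hzY⟩, (Metric.mem_ball.1 hzb).trans_le (min_le_left _ _), n, hn, ?_⟩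
    calc dist (φ^[n] z) z ≤ dist (φ^[n] z) y + dist z y := dist_triangle_right _ _ _
      _ < r + r := add_lt_add hz'b hzb
      _ ≤ 1 / (k + 1 : ℝ) / 2 + 1 / (k + 1 : ℝ) / 2 := by gcongr <;> exact min_le_right _ _
      _ = 1 / (k + 1 : ℝ) := add_halves _
  have hd : Dense (⋂ k, U k) := dense_iInter_of_isOpen hUo hUd
  intro x hx
  have h1 : (⟨x, hx⟩ : Y) ∈ closure (⋂ k, U k) := hd _
  have h2 := image_closure_subset_closure_image continuous_subtype_val ⟨_, h1, rfl⟩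
  refine closure_mono ?_ h2
  rintro _ ⟨y, hy, rfl⟩
  exact mem_recurrentPoints_of_returns φ fun k => Set.mem_iInter.1 hy k

end Dyn
end

/-! ### Closed subspaces of `C₀(X)` and their cosupports. -/

noncomputable section

namespace ZeroAtInftyContinuousMap

open Filter Topology

variable {X : Type u} [TopologicalSpace X]

theorem norm_apply_le_norm (f : C₀(X, ℂ)) (x : X) : ‖f x‖ ≤ ‖f‖ := f.toBCF.norm_coe_le_norm x

theorem norm_le_of_forall {f : C₀(X, ℂ)} {C : ℝ} (hC : 0 ≤ C) (h : ∀ x, ‖f x‖ ≤ C) : ‖f‖ ≤ C :=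
  (BoundedContinuousFunction.norm_le hC).2 h

theorem isClosed_setOf_apply_eq_zero (x : X) : IsClosed {f : C₀(X, ℂ) | f x = 0} :=
  isClosed_eq ((BoundedContinuousFunction.lipschitz_eval_const x).continuous.comp
    isometry_toBCF.continuous)
    continuous_const

/-- A compactly supported real function as an element of `C₀(X, ℂ)`. -/
def ofRealCompactSupport (f : C(X, ℝ)) (hf : HasCompactSupport f) : C₀(X, ℂ) where
  toFun x := (f x : ℂ)
  continuous_toFun := Complex.continuous_ofReal.comp f.continuous
  zero_at_infty' :=
    (hf.comp_left (g := fun r : ℝ => (r : ℂ)) Complex.ofReal_zero).is_zero_at_infty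

theorem ofRealCompactSupport_apply (f : C(X, ℝ)) (hf : HasCompactSupport f) (x : X) :
    ofRealCompactSupport f hf x = (f x : ℂ) := rfl

/-- The points `x` such that no neighbourhood `V` of `x` has all functions vanishing off `V` in
`S`. -/
def cosupport (S : Submodule ℂ C₀(X, ℂ)) : Set X :=
  {x | ∀ V : Set X, IsOpen V → x ∈ V → ∃ f : C₀(X, ℂ), (∀ y ∉ V, f y = 0) ∧ f ∉ S}

theorem notMem_cosupport {S : Submodule ℂ C₀(X, ℂ)} {x : X} :
    x ∉ cosupport S ↔ ∃ V : Set X, IsOpen V ∧ x ∈ V ∧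
      ∀ f : C₀(X, ℂ), (∀ y ∉ V, f y = 0) → f ∈ S := by
  simp only [cosupport, Set.mem_ofPred_eq]
  push Not
  rfl

theorem exists_apply_eq_one [T2Space X] [LocallyCompactSpace X] {x : X} {V : Set X} (hV : IsOpen V)
    (hx : x ∈ V) : ∃ f : C₀(X, ℂ), f x = 1 ∧ (∀ y ∉ V, f y = 0) ∧ ‖f‖ ≤ 1 := by
  obtain ⟨f, h1, h0, hc, h01⟩ := exists_continuous_one_zero_of_isCompact (isCompact_singleton (x := x))
    hV.isClosed_compl (by simpa using hx)
  refine ⟨ofRealCompactSupport f hc, ?_, fun y hy => ?_, norm_le_of_forall zero_le_one fun y => ?_⟩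
  · rw [ofRealCompactSupport_apply, h1 rfl]; simp
  · rw [ofRealCompactSupport_apply, h0 hy]; simp
  · rw [ofRealCompactSupport_apply, Complex.norm_real, Real.norm_of_nonneg (h01 y).1]
    exact (h01 y).2

/-- A function vanishing on the cosupport of a closed subspace belongs to the subspace. -/
theorem mem_of_eq_zero_on_cosupport [T2Space X] [LocallyCompactSpace X]
    {S : Submodule ℂ C₀(X, ℂ)} (hS : IsClosed (S : Set C₀(X, ℂ))) {f : C₀(X, ℂ)}
    (hf : ∀ x ∈ cosupport S, f x = 0) : f ∈ S := by
  rw [← SetLike.mem_coe, ← hS.closure_eq]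
  refine Metric.mem_closure_iff.2 fun ε hε => ?_
  -- `K` is compact and misses the cosupport, so finitely many open sets on which `S` is everything
  -- cover it.
  set K : Set X := {x | ε / 2 ≤ ‖f x‖}
  have hK : IsCompact K := by
    have h1 : ∀ᶠ x in cocompact X, ‖f x‖ < ε / 2 := by
      have := (zero_at_infty f).norm
      rw [norm_zero] at this
      exact this.eventually_lt_const (by positivity)
    obtain ⟨T, hT, hTs⟩ := mem_cocompact.1 h1
    refine hT.of_isClosed_subset (isClosed_le continuous_const f.continuous.norm) fun x hx => ?_
    by_contra hxT
    have h2 : ‖f x‖ < ε / 2 := hTs hxT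
    exact absurd h2 (not_lt.2 hx)
  have hKV : ∀ x ∈ K, ∃ V : Set X, IsOpen V ∧ x ∈ V ∧
      ∀ f : C₀(X, ℂ), (∀ y ∉ V, f y = 0) → f ∈ S := by
    intro x hx
    refine notMem_cosupport.1 fun hxc => ?_
    have hx' : ε / 2 ≤ ‖f x‖ := hx
    rw [hf x hxc, norm_zero] at hx'
    linarith
  choose! V hVo hxV hVS using hKV
  obtain ⟨t, htK, hKt⟩ := hK.elim_nhds_subcover V fun x hx => (hVo x hx).mem_nhds (hxV x hx)
  obtain ⟨p, hpsub, hpc⟩ := PartitionOfUnity.exists_isSubordinate_of_locallyFinite_t2space hK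
    (fun i : t => V i) (fun i => hVo _ (htK _ i.2)) (locallyFinite_of_finite _) (by
      intro x hx
      obtain ⟨y, hy, hxy⟩ := Set.mem_iUnion₂.1 (hKt hx)
      exact Set.mem_iUnion.2 ⟨⟨y, hy⟩, hxy⟩)
  set q : t → C₀(X, ℂ) := fun i => f * ofRealCompactSupport (p i) (hpc i)
  refine ⟨∑ i, q i, sum_mem fun i _ => hVS _ (htK _ i.2) _ fun y hy => ?_, ?_⟩
  · have h0 : p i y = 0 := by
      by_contra hne
      exact hy (hpsub i (subset_tsupport _ hne))
    rw [mul_apply, ofRealCompactSupport_apply, h0, Complex.ofReal_zero, mul_zero]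
  · rw [dist_eq_norm]
    refine (norm_le_of_forall (half_pos hε).le fun x => ?_).trans_lt (half_lt_self hε)
    -- The error vanishes on `K`, where the partition sums to `1`; off `K` it is at most `‖f x‖ < ε
    -- / 2`.
    have hsum : (f - ∑ i, q i) x = f x * ((1 - ∑ i, p i x : ℝ) : ℂ) := by
      have h1 : (∑ i, q i) x = ∑ i, q i x :=
        map_sum (⟨⟨fun g : C₀(X, ℂ) => g x, rfl⟩, fun _ _ => rfl⟩ : C₀(X, ℂ) →+ ℂ) q _
      rw [sub_apply, h1]
      simp only [q, mul_apply, ofRealCompactSupport_apply]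
      rw [← Finset.mul_sum]
      push_cast
      ring
    rw [hsum, norm_mul, Complex.norm_real]
    by_cases hx : x ∈ K
    · have : ∑ i, p i x = 1 := by rw [← finsum_eq_sum_of_fintype]; exact p.sum_eq_one hx
      rw [this, sub_self, norm_zero, mul_zero]
      positivity
    · have hlt : ‖f x‖ < ε / 2 := not_le.1 hx
      have hle : ‖(1 - ∑ i, p i x : ℝ)‖ ≤ 1 := by
        rw [Real.norm_eq_abs, abs_le]
        have h0 : 0 ≤ ∑ i, p i x := Finset.sum_nonneg fun i _ => p.nonneg i x
        have h1 : ∑ i, p i x ≤ 1 := by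
          rw [← finsum_eq_sum_of_fintype]
          exact p.sum_le_one x
        constructor <;> linarith
      calc ‖f x‖ * ‖(1 - ∑ i, p i x : ℝ)‖ ≤ ‖f x‖ * 1 := by gcongr
        _ ≤ ε / 2 := by rw [mul_one]; exact hlt.le

end ZeroAtInftyContinuousMap
end

/-! ### Monomials and Fourier coefficients as contractions. -/

noncomputable section

namespace SemiCrossed

set_option synthInstance.maxHeartbeats 200000

open Filter Topology

variable {X : Type u} [TopologicalSpace X]
variable {H₀ : Type v} [NormedAddCommGroup H₀] [InnerProductSpace ℂ H₀] [CompleteSpace H₀]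
variable (φ : X ≃ₜ X) (ρ : C₀(X, ℂ) →⋆ₙₐ[ℂ] (H₀ →L[ℂ] H₀)) (hρ : Function.Injective ρ)

theorem alpha_apply (n : ℕ) (f : C₀(X, ℂ)) (x : X) : alpha φ n f x = f (φ^[n] x) := rfl

/-- `f ↦ U^n f` as a contraction into the semicrossed product. -/
def monomialL (n : ℕ) : C₀(X, ℂ) →L[ℂ] semicrossedProduct φ ρ :=
  LinearMap.mkContinuous
    { toFun := fun f => ⟨monomial φ ρ n f, monomial_mem φ ρ n f⟩
      map_add' := fun f g => Subtype.ext (monomial_add φ ρ n f g)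
      map_smul' := fun c f => Subtype.ext (monomial_smul φ ρ n c f) } 1
    fun f => by rw [one_mul]; exact norm_monomial_le φ ρ n f

theorem coe_monomialL (n : ℕ) (f : C₀(X, ℂ)) :
    (monomialL φ ρ n f : Amplified H₀ →L[ℂ] Amplified H₀) = monomial φ ρ n f := rfl

theorem norm_monomialL_apply_le (n : ℕ) (f : C₀(X, ℂ)) : ‖monomialL φ ρ n f‖ ≤ ‖f‖ :=
  norm_monomial_le φ ρ n f

theorem monomialL_mul (m n : ℕ) (f g : C₀(X, ℂ)) :
    monomialL φ ρ m f * monomialL φ ρ n g = monomialL φ ρ (m + n) (alpha φ n f * g) :=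
  Subtype.ext (monomial_mul φ ρ m n f g)

theorem monomialL_zero (n : ℕ) : monomialL φ ρ n 0 = 0 := (monomialL φ ρ n).toLinearMap.map_zero

theorem monomialL_add (n : ℕ) (f g : C₀(X, ℂ)) :
    monomialL φ ρ n (f + g) = monomialL φ ρ n f + monomialL φ ρ n g :=
  (monomialL φ ρ n).toLinearMap.map_add f g

theorem monomialL_smul (n : ℕ) (c : ℂ) (f : C₀(X, ℂ)) :
    monomialL φ ρ n (c • f) = c • monomialL φ ρ n f :=
  (monomialL φ ρ n).toLinearMap.map_smul c f

theorem monomialL_sub (n : ℕ) (f g : C₀(X, ℂ)) :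
    monomialL φ ρ n (f - g) = monomialL φ ρ n f - monomialL φ ρ n g :=
  (monomialL φ ρ n).toLinearMap.map_sub f g

theorem norm_compression_apply_le (n : ℕ) (T : Amplified H₀ →L[ℂ] Amplified H₀) :
    ‖compression H₀ n T‖ ≤ ‖T‖ := by
  refine ContinuousLinearMap.opNorm_le_bound _ (norm_nonneg _) fun ξ => ?_
  have h1 : compression H₀ n T ξ = T (lp.single 2 0 ξ) n := rfl
  rw [h1]
  calc ‖T (lp.single 2 0 ξ) n‖ ≤ ‖T (lp.single 2 0 ξ)‖ :=
        lp.norm_apply_le_norm (by norm_num) _ _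
    _ ≤ ‖T‖ * ‖lp.single (E := fun _ : ℕ => H₀) 2 0 ξ‖ := T.le_opNorm _
    _ = ‖T‖ * ‖ξ‖ := by rw [lp.norm_single (by norm_num)]

theorem norm_fourierCoeff_le (n : ℕ) (A : semicrossedProduct φ ρ) :
    ‖fourierCoeff φ ρ hρ n A‖ ≤ ‖A‖ := by
  rw [← NonUnitalStarAlgHom.norm_map ρ hρ, rep_fourierCoeff]
  exact norm_compression_apply_le n _

/-- The Fourier coefficient `E_n` as a contraction. -/
def coeffL (n : ℕ) : semicrossedProduct φ ρ →L[ℂ] C₀(X, ℂ) :=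
  LinearMap.mkContinuous
    { toFun := fourierCoeff φ ρ hρ n
      map_add' := fun A B => hρ (by
        rw [map_add, rep_fourierCoeff, rep_fourierCoeff, rep_fourierCoeff]
        exact map_add (compression H₀ n) _ _)
      map_smul' := fun c A => hρ (by
        rw [RingHom.id_apply, map_smul, rep_fourierCoeff, rep_fourierCoeff]
        exact map_smul (compression H₀ n) _ _) } 1
    fun A => by rw [one_mul]; exact norm_fourierCoeff_le φ ρ hρ n A

theorem coeffL_apply (n : ℕ) (A : semicrossedProduct φ ρ) :
    coeffL φ ρ hρ n A = fourierCoeff φ ρ hρ n A := rfl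

theorem norm_coeffL_apply_le (n : ℕ) (A : semicrossedProduct φ ρ) :
    ‖coeffL φ ρ hρ n A‖ ≤ ‖A‖ := norm_fourierCoeff_le φ ρ hρ n A

theorem coeffL_monomialL (n m : ℕ) (f : C₀(X, ℂ)) :
    coeffL φ ρ hρ n (monomialL φ ρ m f) = if n = m then f else 0 := by
  apply hρ
  rw [coeffL_apply, rep_fourierCoeff, coe_monomialL, compression_monomial]
  split_ifs
  · rfl
  · rw [map_zero]

theorem coeffL_zero (n : ℕ) : coeffL φ ρ hρ n 0 = 0 := (coeffL φ ρ hρ n).toLinearMap.map_zero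

theorem coeffL_add (n : ℕ) (A B : semicrossedProduct φ ρ) :
    coeffL φ ρ hρ n (A + B) = coeffL φ ρ hρ n A + coeffL φ ρ hρ n B :=
  (coeffL φ ρ hρ n).toLinearMap.map_add A B

theorem coeffL_sub (n : ℕ) (A B : semicrossedProduct φ ρ) :
    coeffL φ ρ hρ n (A - B) = coeffL φ ρ hρ n A - coeffL φ ρ hρ n B :=
  (coeffL φ ρ hρ n).toLinearMap.map_sub A B

/-- A closed subspace of the semicrossed product containing all `U^n f` is everything. -/
theorem eq_top_of_monomialL_mem (S : Submodule ℂ (semicrossedProduct φ ρ))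
    (hS : IsClosed (S : Set (semicrossedProduct φ ρ))) (h : ∀ n f, monomialL φ ρ n f ∈ S) :
    S = ⊤ := by
  rw [eq_top_iff]
  rintro ⟨A, hA⟩ -
  obtain ⟨T, hT, hTS⟩ := isClosed_induced_iff.1 hS
  have hsub : ((NonUnitalAlgebra.adjoin ℂ
      {T | ∃ (n : ℕ) (f : C₀(X, ℂ)), T = monomial φ ρ n f} :
        NonUnitalSubalgebra ℂ (Amplified H₀ →L[ℂ] Amplified H₀)) : Set _) ⊆ T := by
    intro P hP
    have hP' : P ∈ Submodule.span ℂ {T | ∃ (n : ℕ) (f : C₀(X, ℂ)), T = monomial φ ρ n f} := by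
      rw [← adjoin_monomial_toSubmodule]; exact hP
    have hle : Submodule.span ℂ {T | ∃ (n : ℕ) (f : C₀(X, ℂ)), T = monomial φ ρ n f} ≤
        S.map (semicrossedProduct φ ρ).toSubmodule.subtype := by
      refine Submodule.span_le.2 ?_
      rintro _ ⟨n, f, rfl⟩
      exact ⟨monomialL φ ρ n f, h n f, rfl⟩
    obtain ⟨Q, hQ, rfl⟩ := hle hP'
    exact hTS.ge hQ
  have hAT : A ∈ T := closure_minimal hsub hT hA
  exact hTS.le (show (⟨A, hA⟩ : semicrossedProduct φ ρ) ∈ Subtype.val ⁻¹' T from hAT)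

end SemiCrossed
end

/-! ### Gauge operators, Abel means and spectral synthesis. -/

noncomputable section

namespace SemiCrossed

set_option synthInstance.maxHeartbeats 200000

open Filter Topology

variable {X : Type u} [TopologicalSpace X]
variable {H₀ : Type v} [NormedAddCommGroup H₀] [InnerProductSpace ℂ H₀]

variable (H₀) in
/-- The diagonal operator `ξ ⊗ e_k ↦ z^k ξ ⊗ e_k`. -/
def gauge (z : ℂ) (hz : ‖z‖ ≤ 1) : Amplified H₀ →L[ℂ] Amplified H₀ :=
  lp.mapCLM 2 (fun k : ℕ => z ^ k • ContinuousLinearMap.id ℂ H₀) zero_le_one (fun k => by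
    refine (norm_smul_le _ _).trans (mul_le_one₀ ?_ (norm_nonneg _) ContinuousLinearMap.norm_id_le)
    rw [norm_pow]
    exact pow_le_one₀ (norm_nonneg _) hz)

theorem gauge_apply (z : ℂ) (hz : ‖z‖ ≤ 1) (ξ : Amplified H₀) (k : ℕ) :
    gauge H₀ z hz ξ k = z ^ k • ξ k := rfl

theorem norm_gauge_le (z : ℂ) (hz : ‖z‖ ≤ 1) : ‖gauge H₀ z hz‖ ≤ 1 :=
  lp.norm_mapCLM_le _ _ _ _

variable [CompleteSpace H₀]
variable (φ : X ≃ₜ X) (ρ : C₀(X, ℂ) →⋆ₙₐ[ℂ] (H₀ →L[ℂ] H₀)) (hρ : Function.Injective ρ)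

/-- A monomial of degree `n` sends coordinate `k` to `k + n`, so it picks up the factor `z^(k+n) w^k
= z^n`. -/
theorem gauge_mul_monomial_mul_gauge {z w : ℂ} (hz : ‖z‖ ≤ 1) (hw : ‖w‖ ≤ 1) (hzw : z * w = 1)
    (n : ℕ) (f : C₀(X, ℂ)) :
    gauge H₀ z hz * monomial φ ρ n f * gauge H₀ w hw = z ^ n • monomial φ ρ n f := by
  ext ξ k
  change gauge H₀ z hz (monomial φ ρ n f (gauge H₀ w hw ξ)) k = z ^ n • monomial φ ρ n f ξ k
  rw [gauge_apply]
  rcases lt_or_ge k n with h | h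
  · rw [monomial_apply_lt _ _ _ _ _ _ h, monomial_apply_lt _ _ _ _ _ _ h, smul_zero, smul_zero]
  obtain ⟨k, rfl⟩ := Nat.exists_eq_add_of_le' h
  rw [monomial_apply_add, monomial_apply_add, gauge_apply, map_smul, smul_smul]
  congr 1
  rw [pow_add, mul_right_comm, ← mul_pow, hzw, one_pow, one_mul]

/-- By the maximum modulus principle, `‖∑ z^n U^n f_n‖ ≤ ‖∑ U^n f_n‖` for `|z| ≤ 1`. -/
theorem norm_sum_pow_smul_monomial_le (s : Finset ℕ) (f : ℕ → C₀(X, ℂ)) {z : ℂ} (hz : ‖z‖ ≤ 1) :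
    ‖∑ n ∈ s, z ^ n • monomial φ ρ n (f n)‖ ≤ ‖∑ n ∈ s, monomial φ ρ n (f n)‖ := by
  refine Complex.norm_le_of_forall_mem_frontier_norm_le (U := Metric.ball (0 : ℂ) 1)
    (f := fun z => ∑ n ∈ s, z ^ n • monomial φ ρ n (f n)) Metric.isBounded_ball ?_ ?_ ?_
  · refine Differentiable.diffContOnCl ?_
    exact Differentiable.fun_sum fun n _ => (differentiable_id.pow n).smul_const _
  · intro z hz
    rw [frontier_ball _ one_ne_zero, mem_sphere_zero_iff_norm] at hz
    have hw : ‖z⁻¹‖ ≤ 1 := by rw [norm_inv, hz, inv_one]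
    have hz0 : z ≠ 0 := by rintro rfl; simp at hz
    -- On the unit circle both `z` and `z⁻¹` give contractive gauge operators, which conjugate the
    -- sum at `1` into the sum at `z`.
    have e : ∑ n ∈ s, z ^ n • monomial φ ρ n (f n) =
        gauge H₀ z hz.le * (∑ n ∈ s, monomial φ ρ n (f n)) * gauge H₀ z⁻¹ hw := by
      rw [Finset.mul_sum, Finset.sum_mul]
      exact Finset.sum_congr rfl fun n _ =>
        (gauge_mul_monomial_mul_gauge φ ρ hz.le hw (mul_inv_cancel₀ hz0) n (f n)).symm
    rw [e]
    set P := ∑ n ∈ s, monomial φ ρ n (f n)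
    calc ‖gauge H₀ z hz.le * P * gauge H₀ z⁻¹ hw‖
        ≤ ‖gauge H₀ z hz.le‖ * ‖P‖ * ‖gauge H₀ z⁻¹ hw‖ :=
          (norm_mul_le _ _).trans (by gcongr; exact norm_mul_le _ _)
      _ ≤ 1 * ‖P‖ * 1 := by gcongr <;> exact norm_gauge_le _ _
      _ = ‖P‖ := by rw [one_mul, mul_one]
  · rw [closure_ball _ one_ne_zero, mem_closedBall_zero_iff]
    exact hz

instance : CompleteSpace (semicrossedProduct φ ρ) :=
  (NonUnitalSubalgebra.isClosed_topologicalClosure _).completeSpace_coe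

theorem summable_abel {r : ℝ} (hr0 : 0 ≤ r) (hr1 : r < 1) (A : semicrossedProduct φ ρ) :
    Summable fun n => monomialL φ ρ n ((r : ℂ) ^ n • coeffL φ ρ hρ n A) := by
  refine Summable.of_norm_bounded ((summable_geometric_of_lt_one hr0 hr1).mul_right ‖A‖) fun n => ?_
  refine (norm_monomialL_apply_le φ ρ n _).trans ?_
  rw [norm_smul, norm_pow, Complex.norm_real, Real.norm_of_nonneg hr0]
  gcongr
  exact norm_coeffL_apply_le φ ρ hρ n A

/-- The Abel mean `∑ r^n U^n E_n(A)`. -/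
def abel (r : ℝ) (A : semicrossedProduct φ ρ) : semicrossedProduct φ ρ :=
  ∑' n, monomialL φ ρ n ((r : ℂ) ^ n • coeffL φ ρ hρ n A)

theorem abel_sub {r : ℝ} (hr0 : 0 ≤ r) (hr1 : r < 1) (A B : semicrossedProduct φ ρ) :
    abel φ ρ hρ r (A - B) = abel φ ρ hρ r A - abel φ ρ hρ r B := by
  unfold abel
  rw [← (summable_abel φ ρ hρ hr0 hr1 A).tsum_sub (summable_abel φ ρ hρ hr0 hr1 B)]
  refine tsum_congr fun n => ?_
  rw [← monomialL_sub, coeffL_sub]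
  exact congrArg _ (by ext x; exact mul_sub _ _ _)

/-- This bound blows up as `r → 1`; it serves only to make each Abel mean continuous, so that the
uniform bound can be checked on polynomials. -/
theorem norm_abel_le_div {r : ℝ} (hr0 : 0 ≤ r) (hr1 : r < 1) (A : semicrossedProduct φ ρ) :
    ‖abel φ ρ hρ r A‖ ≤ (1 - r)⁻¹ * ‖A‖ := by
  refine tsum_of_norm_bounded ((hasSum_geometric_of_lt_one hr0 hr1).mul_right ‖A‖) fun n => ?_
  refine (norm_monomialL_apply_le φ ρ n _).trans ?_
  rw [norm_smul, norm_pow, Complex.norm_real, Real.norm_of_nonneg hr0]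
  gcongr
  exact norm_coeffL_apply_le φ ρ hρ n A

theorem continuous_abel {r : ℝ} (hr0 : 0 ≤ r) (hr1 : r < 1) : Continuous (abel φ ρ hρ r) := by
  refine (LipschitzWith.of_dist_le_mul (K := ⟨(1 - r)⁻¹, inv_nonneg.2 (sub_nonneg.2 hr1.le)⟩)
    fun A B => ?_).continuous
  rw [dist_eq_norm, dist_eq_norm, ← abel_sub φ ρ hρ hr0 hr1]
  exact norm_abel_le_div φ ρ hρ hr0 hr1 _

/-- The elements of the form `∑_{n < N} U^n f_n`. -/
def polynomials : Submodule ℂ (semicrossedProduct φ ρ) :=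
  ⨆ n, LinearMap.range (monomialL φ ρ n).toLinearMap

theorem exists_eq_sum_of_mem_polynomials {P : semicrossedProduct φ ρ} (hP : P ∈ polynomials φ ρ) :
    ∃ N, (∀ n ≥ N, coeffL φ ρ hρ n P = 0) ∧
      P = ∑ n ∈ Finset.range N, monomialL φ ρ n (coeffL φ ρ hρ n P) := by
  -- Allowing every cutoff `M ≥ N` lets two polynomials be added at a common cutoff.
  suffices h : ∃ N, ∀ M ≥ N, coeffL φ ρ hρ M P = 0 ∧
      P = ∑ n ∈ Finset.range M, monomialL φ ρ n (coeffL φ ρ hρ n P) by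
    obtain ⟨N, hN⟩ := h
    exact ⟨N, fun n hn => (hN n hn).1, (hN N le_rfl).2⟩
  refine Submodule.iSup_induction _ (motive := fun P => ∃ N, ∀ M ≥ N, coeffL φ ρ hρ M P = 0 ∧
      P = ∑ n ∈ Finset.range M, monomialL φ ρ n (coeffL φ ρ hρ n P)) hP ?_ ?_ ?_
  · rintro n _ ⟨f, rfl⟩
    refine ⟨n + 1, fun M hM => ⟨?_, ?_⟩⟩
    · rw [ContinuousLinearMap.coe_coe, coeffL_monomialL, if_neg (by omega)]
    · rw [ContinuousLinearMap.coe_coe, Finset.sum_eq_single n]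
      · rw [coeffL_monomialL, if_pos rfl]
      · intro k _ hk
        rw [coeffL_monomialL, if_neg hk, monomialL_zero]
      · intro h
        exact absurd (Finset.mem_range.2 (by omega)) h
  · exact ⟨0, fun M _ => ⟨coeffL_zero φ ρ hρ M, by simp [coeffL_zero, monomialL_zero]⟩⟩
  · rintro P Q ⟨N, hN⟩ ⟨N', hN'⟩
    refine ⟨max N N', fun M hM => ?_⟩
    obtain ⟨h1, h2⟩ := hN M (le_of_max_le_left hM)
    obtain ⟨h3, h4⟩ := hN' M (le_of_max_le_right hM)
    refine ⟨by rw [coeffL_add, h1, h3, add_zero], ?_⟩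
    simp only [coeffL_add, monomialL_add, Finset.sum_add_distrib]
    rw [← h2, ← h4]

theorem dense_polynomials : Dense (polynomials φ ρ : Set (semicrossedProduct φ ρ)) := by
  have := eq_top_of_monomialL_mem φ ρ (polynomials φ ρ).topologicalClosure
    (Submodule.isClosed_topologicalClosure _) fun n f =>
      Submodule.le_topologicalClosure _ (Submodule.mem_iSup_of_mem n ⟨f, rfl⟩)
  exact (Submodule.dense_iff_topologicalClosure_eq_top).2 this

theorem abel_eq_sum {P : semicrossedProduct φ ρ} {N : ℕ}
    (hN : ∀ n ≥ N, coeffL φ ρ hρ n P = 0) (r : ℝ) :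
    abel φ ρ hρ r P =
      ∑ n ∈ Finset.range N, monomialL φ ρ n ((r : ℂ) ^ n • coeffL φ ρ hρ n P) := by
  refine tsum_eq_sum fun n hn => ?_
  rw [hN n (by simpa using hn), smul_zero, monomialL_zero]

theorem norm_abel_le {r : ℝ} (hr0 : 0 ≤ r) (hr1 : r < 1) (A : semicrossedProduct φ ρ) :
    ‖abel φ ρ hρ r A‖ ≤ ‖A‖ := by
  refine (dense_polynomials φ ρ).induction (P := fun A => ‖abel φ ρ hρ r A‖ ≤ ‖A‖)
    (fun P hP => ?_) (isClosed_le (continuous_abel φ ρ hρ hr0 hr1).norm continuous_norm) A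
  obtain ⟨N, hN, hsum⟩ := exists_eq_sum_of_mem_polynomials φ ρ hρ hP
  have h := norm_sum_pow_smul_monomial_le φ ρ (Finset.range N) (fun n => coeffL φ ρ hρ n P)
    (z := (r : ℂ)) (by rw [Complex.norm_real, Real.norm_of_nonneg hr0]; exact hr1.le)
  have e1 : ((abel φ ρ hρ r P : semicrossedProduct φ ρ) : Amplified H₀ →L[ℂ] Amplified H₀) =
      ∑ n ∈ Finset.range N, (r : ℂ) ^ n • monomial φ ρ n (coeffL φ ρ hρ n P) := by
    rw [abel_eq_sum φ ρ hρ hN]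
    simp only [← monomial_smul]
    exact map_sum (semicrossedProduct φ ρ).toSubmodule.subtype _ _
  have e2 : (P : Amplified H₀ →L[ℂ] Amplified H₀) =
      ∑ n ∈ Finset.range N, monomial φ ρ n (coeffL φ ρ hρ n P) := by
    conv_lhs => rw [hsum]
    exact map_sum (semicrossedProduct φ ρ).toSubmodule.subtype _ _
  rw [← e1, ← e2] at h
  exact h

/-- Spectral synthesis: `A` lies in each closed subspace that contains all `U^n E_n(A)`. -/
theorem mem_of_forall_monomialL_coeffL_mem (S : Submodule ℂ (semicrossedProduct φ ρ))
    (hS : IsClosed (S : Set (semicrossedProduct φ ρ))) {A : semicrossedProduct φ ρ}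
    (h : ∀ n, monomialL φ ρ n (coeffL φ ρ hρ n A) ∈ S) : A ∈ S := by
  rw [← SetLike.mem_coe, ← hS.closure_eq]
  refine Metric.mem_closure_iff.2 fun ε hε => ?_
  obtain ⟨P, hP, hAP⟩ := (dense_polynomials φ ρ).exists_dist_lt A (ε := ε / 3) (by positivity)
  obtain ⟨N, hN, hsum⟩ := exists_eq_sum_of_mem_polynomials φ ρ hρ hP
  -- For a polynomial the Abel mean is a finite sum, continuous in `r` and equal to `P` at `r = 1`.
  -- Contractivity of Abel means then transfers the approximation to `A`.
  have hlim : Tendsto (fun r : ℝ => abel φ ρ hρ r P) (𝓝[<] 1) (𝓝 P) := by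
    have hc : Continuous fun r : ℝ => abel φ ρ hρ r P := by
      simp_rw [abel_eq_sum φ ρ hρ hN]
      exact continuous_finsetSum _ fun n _ => (monomialL φ ρ n).continuous.comp
        ((Complex.continuous_ofReal.pow n).smul continuous_const)
    have h1 : abel φ ρ hρ 1 P = P := by
      rw [abel_eq_sum φ ρ hρ hN]
      simpa using hsum.symm
    have := (hc.tendsto 1).mono_left (nhdsWithin_le_nhds (s := Set.Iio 1))
    rwa [h1] at this
  obtain ⟨r, ⟨hPr, hr0⟩, hr1⟩ := (((Metric.tendsto_nhds.1 hlim (ε / 3) (by positivity)).and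
    (nhdsWithin_le_nhds (lt_mem_nhds zero_lt_one))).and self_mem_nhdsWithin).exists
  refine ⟨abel φ ρ hρ r A, ?_, ?_⟩
  · exact hS.mem_of_tendsto (summable_abel φ ρ hρ hr0.le hr1 A).hasSum
      (Eventually.of_forall fun s => sum_mem fun n _ => by
        rw [monomialL_smul]
        exact S.smul_mem _ (h n))
  · have h1 : dist (abel φ ρ hρ r P) (abel φ ρ hρ r A) < ε / 3 := by
      rw [dist_eq_norm, ← abel_sub φ ρ hρ hr0.le hr1]
      refine (norm_abel_le φ ρ hρ hr0.le hr1 _).trans_lt ?_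
      exact (dist_eq_norm P A).symm.trans_lt (dist_comm A P ▸ hAP)
    calc dist A (abel φ ρ hρ r A) ≤ dist A P + dist P (abel φ ρ hρ r P) +
          dist (abel φ ρ hρ r P) (abel φ ρ hρ r A) := dist_triangle4 _ _ _ _
      _ < ε / 3 + ε / 3 + ε / 3 := by
          rw [dist_comm P]
          gcongr
      _ = ε := by ring

end SemiCrossed
end

/-! ### Abstract Fourier systems, convolution and vanishing ideals. -/

noncomputable section

namespace SemiCrossed

open Filter Topology

/-- A normed algebra with a dense span of monomials `U^n f` subject to the covariance relation, and
with contractive Fourier coefficient maps satisfying spectral synthesis. -/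
structure FourierSystem {X : Type u} [TopologicalSpace X] (φ : X ≃ₜ X) (A : Type v)
    [NonUnitalNormedRing A] [NormedSpace ℂ A] where
  mono : ℕ → C₀(X, ℂ) →ₗ[ℂ] A
  norm_mono_le : ∀ n f, ‖mono n f‖ ≤ ‖f‖
  mono_mul : ∀ m n f g, mono m f * mono n g = mono (m + n) (alpha φ n f * g)
  coeff : ℕ → A →ₗ[ℂ] C₀(X, ℂ)
  norm_coeff_le : ∀ n a, ‖coeff n a‖ ≤ ‖a‖
  coeff_mono : ∀ n m f, coeff n (mono m f) = if n = m then f else 0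
  mem_of_forall_mono_coeff_mem : ∀ S : Submodule ℂ A, IsClosed (S : Set A) →
    ∀ a, (∀ n, mono n (coeff n a) ∈ S) → a ∈ S

namespace FourierSystem

variable {X : Type u} [TopologicalSpace X] {φ : X ≃ₜ X} {A : Type v}
    [NonUnitalNormedRing A] [NormedSpace ℂ A] (F : FourierSystem φ A)

theorem continuous_mono (n : ℕ) : Continuous (F.mono n) :=
  AddMonoidHomClass.continuous_of_bound (F.mono n) 1 fun f => by
    rw [one_mul]; exact F.norm_mono_le n f

/-- The functional `a ↦ E_n(a)(x)`. -/
def coeffAt (n : ℕ) (x : X) : A →L[ℂ] ℂ :=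
  LinearMap.mkContinuous
    { toFun := fun a => F.coeff n a x
      map_add' := fun a b => by rw [map_add]; rfl
      map_smul' := fun c a => by rw [map_smul]; rfl } 1
    fun a => by
      rw [one_mul]
      exact (ZeroAtInftyContinuousMap.norm_apply_le_norm _ x).trans (F.norm_coeff_le n a)

theorem coeffAt_apply (n : ℕ) (x : X) (a : A) : F.coeffAt n x a = F.coeff n a x := rfl

theorem norm_coeffAt_apply_le (n : ℕ) (x : X) (a : A) : ‖F.coeffAt n x a‖ ≤ ‖a‖ :=
  (ZeroAtInftyContinuousMap.norm_apply_le_norm _ x).trans (F.norm_coeff_le n a)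

theorem coeffAt_mono (n m : ℕ) (x : X) (f : C₀(X, ℂ)) :
    F.coeffAt n x (F.mono m f) = if n = m then f x else 0 := by
  rw [coeffAt_apply, F.coeff_mono]
  split_ifs <;> rfl

/-- Synthesis applied to the closed preimage of `S`; thus continuous linear statements need checking
only on monomials. -/
theorem apply_mem_of_forall_mono {M : Type*} [AddCommGroup M] [Module ℂ M] [TopologicalSpace M]
    (T : A →ₗ[ℂ] M) (hT : Continuous T) (S : Submodule ℂ M) (hS : IsClosed (S : Set M))
    (h : ∀ n f, T (F.mono n f) ∈ S) (a : A) : T a ∈ S :=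
  F.mem_of_forall_mono_coeff_mem (S.comap T) (hS.preimage hT) a fun n => h n _

theorem apply_eq_of_forall_mono {T T' : A →ₗ[ℂ] ℂ} (hT : Continuous T) (hT' : Continuous T')
    (h : ∀ n f, T (F.mono n f) = T' (F.mono n f)) (a : A) : T a = T' a := by
  have := F.apply_mem_of_forall_mono (T - T') (hT.sub hT') ⊥ isClosed_singleton
    (fun n f => by simp [h n f]) a
  simpa [sub_eq_zero] using this

/-- On `Y`, the first nonvanishing Fourier coefficient of `a` is the `m`-th one, equal to `f`. -/
structure HasLeadingCoeff (Y : Set X) (m : ℕ) (a : A) (f : X → ℂ) : Prop where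
  eq_zero : ∀ k < m, ∀ x ∈ Y, F.coeffAt k x a = 0
  eq_apply : ∀ x ∈ Y, F.coeffAt m x a = f x

theorem hasLeadingCoeff_mono (Y : Set X) (m : ℕ) (f : C₀(X, ℂ)) :
    F.HasLeadingCoeff Y m (F.mono m f) f where
  eq_zero k hk x _ := by rw [coeffAt_mono, if_neg hk.ne]
  eq_apply x _ := by rw [coeffAt_mono, if_pos rfl]

section Convolution

variable [IsScalarTower ℂ A A] [SMulCommClass ℂ A A]

/-- The convolution formula for Fourier coefficients. -/
theorem coeffAt_mul (n : ℕ) (x : X) (a b : A) :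
    F.coeffAt n x (a * b) = ∑ p ∈ Finset.HasAntidiagonal.antidiagonal n,
      F.coeffAt p.1 (φ^[p.2] x) a * F.coeffAt p.2 x b := by
  -- Both sides are linear and continuous in each factor: first `b` is reduced to monomials with `a`
  -- a monomial, then `a` is freed.
  have key : ∀ m f b, F.coeffAt n x (F.mono m f * b) =
      ∑ p ∈ Finset.HasAntidiagonal.antidiagonal n,
        F.coeffAt p.1 (φ^[p.2] x) (F.mono m f) * F.coeffAt p.2 x b := by
    intro m f b
    have := F.apply_eq_of_forall_mono
      (T := (F.coeffAt n x).toLinearMap ∘ₗ LinearMap.mulLeft ℂ (F.mono m f))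
      (T' := ∑ p ∈ Finset.HasAntidiagonal.antidiagonal n,
        F.coeffAt p.1 (φ^[p.2] x) (F.mono m f) • (F.coeffAt p.2 x).toLinearMap)
      ((F.coeffAt n x).continuous.comp (continuous_const.mul continuous_id)) ?_ ?_ b
    · simpa [LinearMap.sum_apply] using this
    · simp only [LinearMap.coe_sum, LinearMap.coe_smul]
      rw [Finset.sum_fn]
      exact continuous_finsetSum _ fun p _ => (F.coeffAt _ _).continuous.const_smul _
    intro k g
    simp only [LinearMap.comp_apply, LinearMap.mulLeft_apply, LinearMap.sum_apply,
      LinearMap.smul_apply, smul_eq_mul, ContinuousLinearMap.coe_coe]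
    rw [F.mono_mul, coeffAt_mono]
    simp only [coeffAt_mono]
    by_cases hn : n = m + k
    · rw [if_pos hn, Finset.sum_eq_single (m, k)]
      · simp [alpha_apply]
      · rintro ⟨c, d⟩ hab hne
        rcases eq_or_ne c m with rfl | ha
        · rcases eq_or_ne d k with rfl | hb
          · exact absurd rfl hne
          · simp [hb]
        · simp [ha]
      · intro h
        exact absurd (Finset.HasAntidiagonal.mem_antidiagonal.2 hn.symm) h
    · rw [if_neg hn]
      refine (Finset.sum_eq_zero fun p hp => ?_).symm
      rw [Finset.HasAntidiagonal.mem_antidiagonal] at hp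
      by_cases ha : p.1 = m
      · rw [if_neg (show p.2 ≠ k by omega), mul_zero]
      · rw [if_neg ha, zero_mul]
  have := F.apply_eq_of_forall_mono
    (T := (F.coeffAt n x).toLinearMap ∘ₗ LinearMap.mulRight ℂ b)
    (T' := ∑ p ∈ Finset.HasAntidiagonal.antidiagonal n,
      F.coeffAt p.2 x b • (F.coeffAt p.1 (φ^[p.2] x)).toLinearMap)
    ((F.coeffAt n x).continuous.comp (continuous_id.mul continuous_const)) ?_ ?_ a
  · simpa [LinearMap.sum_apply, mul_comm (F.coeffAt _ x b)] using this
  · simp only [LinearMap.coe_sum, LinearMap.coe_smul]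
    rw [Finset.sum_fn]
    exact continuous_finsetSum _ fun p _ => (F.coeffAt _ _).continuous.const_smul _
  · intro m f
    simpa [LinearMap.sum_apply, mul_comm (F.coeffAt _ x b)] using key m f b

/-- Evaluating `E_0` at a point is multiplicative, which is why the condition on `P` in
`vanishingIdeal` needs no invariance of `P`. -/
theorem coeffAt_zero_mul (x : X) (a b : A) :
    F.coeffAt 0 x (a * b) = F.coeffAt 0 x a * F.coeffAt 0 x b := by
  simp [coeffAt_mul]

/-- Leading coefficients multiply. -/
theorem HasLeadingCoeff.mul {F : FourierSystem φ A} {Y : Set X}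
    (hY : ∀ n : ℕ, ∀ x ∈ Y, φ^[n] x ∈ Y) {a b : A} {m n : ℕ} {f g : X → ℂ}
    (ha : F.HasLeadingCoeff Y m a f) (hb : F.HasLeadingCoeff Y n b g) :
    F.HasLeadingCoeff Y (m + n) (a * b) (fun x => f (φ^[n] x) * g x) where
  eq_zero k hk x hx := by
    rw [coeffAt_mul]
    refine Finset.sum_eq_zero fun p hp => ?_
    rw [Finset.HasAntidiagonal.mem_antidiagonal] at hp
    by_cases h : p.1 < m
    · rw [ha.eq_zero _ h _ (hY _ x hx), zero_mul]
    · rw [hb.eq_zero _ (by omega) x hx, mul_zero]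
  eq_apply x hx := by
    rw [coeffAt_mul, Finset.sum_eq_single (m, n), ha.eq_apply _ (hY _ x hx), hb.eq_apply x hx]
    · rintro ⟨c, d⟩ hp hne
      rw [Finset.HasAntidiagonal.mem_antidiagonal] at hp
      simp only at hp ⊢
      by_cases h : c < m
      · rw [ha.eq_zero _ h _ (hY _ x hx), zero_mul]
      · have hd : d < n := by
          refine lt_of_le_of_ne (by omega) fun hd => hne ?_
          rw [show c = m by omega, hd]
        rw [hb.eq_zero _ hd x hx, mul_zero]
    · intro h
      exact absurd (Finset.HasAntidiagonal.mem_antidiagonal.2 (rfl : (m, n).1 + (m, n).2 = m + n)) h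

/-- The elements `a` with `E_0(a) = 0` on `P` and `E_n(a) = 0` on `Y` for all `n`. -/
def vanishingIdeal (P Y : Set X) (hY : ∀ n : ℕ, ∀ x ∈ Y, φ^[n] x ∈ Y) :
    NonUnitalSubalgebra ℂ A where
  carrier := {a | (∀ x ∈ P, F.coeffAt 0 x a = 0) ∧ ∀ n, ∀ x ∈ Y, F.coeffAt n x a = 0}
  zero_mem' := ⟨fun x _ => map_zero _, fun n x _ => map_zero _⟩
  add_mem' := fun ha hb => ⟨fun x hx => by rw [map_add, ha.1 x hx, hb.1 x hx, add_zero],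
    fun n x hx => by rw [map_add, ha.2 n x hx, hb.2 n x hx, add_zero]⟩
  smul_mem' := fun c a ha => ⟨fun x hx => by rw [map_smul, ha.1 x hx, smul_zero],
    fun n x hx => by rw [map_smul, ha.2 n x hx, smul_zero]⟩
  mul_mem' := fun {a b} ha hb => ⟨fun x hx => by rw [coeffAt_zero_mul, ha.1 x hx, zero_mul],
    fun n x hx => by
      rw [coeffAt_mul]
      exact Finset.sum_eq_zero fun p _ => by rw [ha.2 _ _ (hY _ x hx), zero_mul]⟩

variable {F} in
theorem mem_vanishingIdeal {P Y : Set X} {hY : ∀ n : ℕ, ∀ x ∈ Y, φ^[n] x ∈ Y} {a : A} :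
    a ∈ F.vanishingIdeal P Y hY ↔
      (∀ x ∈ P, F.coeffAt 0 x a = 0) ∧ ∀ n, ∀ x ∈ Y, F.coeffAt n x a = 0 := Iff.rfl

theorem isClosedIdeal_vanishingIdeal (P Y : Set X) (hY : ∀ n : ℕ, ∀ x ∈ Y, φ^[n] x ∈ Y) :
    BanachAlg.IsClosedIdeal (F.vanishingIdeal P Y hY) where
  isClosed := by
    have : (F.vanishingIdeal P Y hY : Set A) =
        (⋂ x ∈ P, {a | F.coeffAt 0 x a = 0}) ∩ ⋂ n, ⋂ x ∈ Y, {a | F.coeffAt n x a = 0} := by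
      ext a
      simp [mem_vanishingIdeal]
    rw [this]
    exact (isClosed_biInter fun x _ => isClosed_eq (F.coeffAt 0 x).continuous continuous_const).inter
      (isClosed_iInter fun n => isClosed_biInter fun x _ =>
        isClosed_eq (F.coeffAt n x).continuous continuous_const)
  mul_mem_left a b hb := ⟨fun x hx => by rw [coeffAt_zero_mul, hb.1 x hx, mul_zero],
    fun n x hx => by
      rw [coeffAt_mul]
      exact Finset.sum_eq_zero fun p _ => by rw [hb.2 _ _ hx, mul_zero]⟩
  mul_mem_right a b hb := ⟨fun x hx => by rw [coeffAt_zero_mul, hb.1 x hx, zero_mul],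
    fun n x hx => by
      rw [coeffAt_mul]
      exact Finset.sum_eq_zero fun p _ => by rw [hb.2 _ _ (hY _ x hx), zero_mul]⟩

theorem mono_mem_vanishingIdeal {P Y : Set X} (hY : ∀ n : ℕ, ∀ x ∈ Y, φ^[n] x ∈ Y) {n : ℕ}
    {f : C₀(X, ℂ)} (hfP : n = 0 → ∀ x ∈ P, f x = 0) (hfY : ∀ x ∈ Y, f x = 0) :
    F.mono n f ∈ F.vanishingIdeal P Y hY := by
  refine ⟨fun x hx => ?_, fun k x hx => ?_⟩
  · rw [coeffAt_mono]
    split_ifs with h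
    · exact hfP h.symm x hx
    · rfl
  · rw [coeffAt_mono, hfY x hx, ite_self]

end Convolution

end FourierSystem
end SemiCrossed
end

/-! ### Maximality and hypocompactness of the vanishing ideal. -/

noncomputable section

namespace SemiCrossed

open Filter Topology

namespace FourierSystem

variable {X : Type u} [TopologicalSpace X] {φ : X ≃ₜ X} {A : Type v}
    [NonUnitalNormedRing A] [NormedSpace ℂ A] (F : FourierSystem φ A)
    [IsScalarTower ℂ A A] [SMulCommClass ℂ A A]

/-- If `a` has a nonzero Fourier coefficient at a recurrent point, there is a bounded sequence `y_i`
in the ideal generated by `a` for which the elements `a y_i a` have leading coefficients of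
increasing degree, bounded away from zero at a fixed point. -/
theorem exists_separated_of_recurrent [T2Space X] [LocallyCompactSpace X] {Y : Set X}
    (hY : ∀ n : ℕ, ∀ x ∈ Y, φ^[n] x ∈ Y) {x : X} (hxY : x ∈ Y) (hx : x ∈ Dyn.recurrentPoints φ)
    {a : A} {n : ℕ} (ha : ∀ k < n, ∀ x ∈ Y, F.coeffAt k x a = 0) (hax : F.coeffAt n x a ≠ 0) :
    ∃ (b c : ℕ → A) (N : ℕ → ℕ) (ε : ℝ), 0 < ε ∧ (∀ i, ‖b i * a * c i‖ ≤ ‖a‖) ∧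
      (∀ i j, i < j → F.coeffAt (N i) x (a * (b j * a * c j) * a) = 0) ∧
      ∀ i, ε ≤ ‖F.coeffAt (N i) x (a * (b i * a * c i) * a)‖ := by
  set f : C₀(X, ℂ) := F.coeff n a
  have hfx : 0 < ‖f x‖ := norm_pos_iff.2 hax
  set V : Set X := {z | ‖f x‖ / 2 < ‖f z‖}
  have hV : V ∈ 𝓝 x := (isOpen_lt continuous_const f.continuous.norm).mem_nhds (half_lt_self hfx)
  have hfreq : ∃ᶠ m in atTop, φ^[m] x ∈ V := mapClusterPt_iff_frequently.1 hx V hV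
  obtain ⟨m₀, hm₀V, hm₀⟩ := (hfreq.and_eventually (eventually_ge_atTop n)).exists
  obtain ⟨l, rfl⟩ := Nat.exists_eq_add_of_le' hm₀
  -- The leading coefficient of `a (U^k g · a · U^l h) a` at `x` contains `f` at times `k + n + l +
  -- n`, `l + n` and `0`. So `l + n` and `ψ i = k i + n + l + n` are chosen as return times to `V`;
  -- `g` and `h` are `1` at the points where they get evaluated.
  obtain ⟨ψ, hψ, hψV⟩ := extraction_of_frequently_atTop
    (hfreq.and_eventually (eventually_ge_atTop (n + (l + n))))
  choose hψV hψn using hψV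
  choose k hk using fun i => Nat.exists_eq_add_of_le' (hψn i)
  obtain ⟨g, hg, -, hg1⟩ := ZeroAtInftyContinuousMap.exists_apply_eq_one isOpen_univ
    (Set.mem_univ (φ^[n] (φ^[l] (φ^[n] x))))
  obtain ⟨h, hh, -, hh1⟩ := ZeroAtInftyContinuousMap.exists_apply_eq_one isOpen_univ
    (Set.mem_univ (φ^[n] x))
  have hlead : F.HasLeadingCoeff Y n a f := ⟨ha, fun _ _ => rfl⟩
  have hprod : ∀ i, F.HasLeadingCoeff Y (n + (k i + n + l) + n)
      (a * (F.mono (k i) g * a * F.mono l h) * a) _ := fun i =>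
    (hlead.mul hY (((F.hasLeadingCoeff_mono Y (k i) g).mul hY hlead).mul hY
      (F.hasLeadingCoeff_mono Y l h))).mul hY hlead
  refine ⟨fun i => F.mono (k i) g, fun _ => F.mono l h, fun i => n + (k i + n + l) + n,
    ‖f x‖ / 2 * (‖f x‖ / 2) * ‖f x‖, by positivity, fun i => ?_, fun i j hij => ?_, fun i => ?_⟩
  · calc ‖F.mono (k i) g * a * F.mono l h‖ ≤ ‖F.mono (k i) g‖ * ‖a‖ * ‖F.mono l h‖ :=
          (norm_mul_le _ _).trans (by gcongr; exact norm_mul_le _ _)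
      _ ≤ 1 * ‖a‖ * 1 := by
          gcongr
          · exact (F.norm_mono_le _ _).trans hg1
          · exact (F.norm_mono_le _ _).trans hh1
      _ = ‖a‖ := by rw [one_mul, mul_one]
  · refine (hprod j).eq_zero _ ?_ x hxY
    have h1 := hψ hij
    have h2 := hk i
    have h3 := hk j
    simp only
    omega
  · have hi := (hprod i).eq_apply x hxY
    have e1 : φ^[k i + n + l] (φ^[n] x) = φ^[ψ i] x := by
      rw [← Function.iterate_add_apply, hk i]
      congr 1
      ring_nf
    have e2 : φ^[l] (φ^[n] x) = φ^[l + n] x := (Function.iterate_add_apply _ _ _ _).symm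
    simp only
    rw [hi, e1, hg, hh, e2, one_mul, mul_one, norm_mul, norm_mul]
    gcongr
    · exact (hψV i).le
    · exact hm₀V.le

/-- If `E_0(a)` is nonzero somewhere on the perfect set `P`, there is a bounded sequence `y_i` in the
ideal generated by `a` for which the functions `E_0(a y_i a)` are separated. -/
theorem exists_separated_of_preperfect [T2Space X] [LocallyCompactSpace X] {P : Set X}
    (hP : Preperfect P) {x : X} (hxP : x ∈ P) {a : A} (hax : F.coeffAt 0 x a ≠ 0) :
    ∃ (b : ℕ → A) (z : ℕ → X) (ε : ℝ), 0 < ε ∧ (∀ i, z i ∈ P) ∧ (∀ i, ‖b i * a‖ ≤ ‖a‖) ∧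
      (∀ i j, i < j → F.coeffAt 0 (z i) (a * (b j * a) * a) = 0) ∧
      ∀ i, ε ≤ ‖F.coeffAt 0 (z i) (a * (b i * a) * a)‖ := by
  set f : C₀(X, ℂ) := F.coeff 0 a
  have hfx : 0 < ‖f x‖ := norm_pos_iff.2 hax
  set V : Set X := {z | ‖f x‖ / 2 < ‖f z‖}
  have hV : IsOpen V := isOpen_lt continuous_const f.continuous.norm
  have hinf : (V ∩ P).Infinite :=
    Set.Infinite.of_accPt (hP.open_inter hV x ⟨half_lt_self hfx, hxP⟩)
  set z : ℕ → X := fun i => hinf.natEmbedding _ i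
  have hz : ∀ i, z i ∈ V ∩ P := fun i => (hinf.natEmbedding _ i).2
  have hzinj : Function.Injective z := Subtype.val_injective.comp (hinf.natEmbedding _).injective
  -- Each `g i` peaks at `z i` and vanishes at the earlier points, so evaluation at `z i` kills all
  -- later terms.
  have hg : ∀ i, ∃ g : C₀(X, ℂ), g (z i) = 1 ∧ (∀ y ∉ (z '' Set.Iio i)ᶜ, g y = 0) ∧ ‖g‖ ≤ 1 :=
    fun i => ZeroAtInftyContinuousMap.exists_apply_eq_one
      ((Set.finite_Iio i).image z).isClosed.isOpen_compl (by
        rintro ⟨j, hj, hij⟩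
        exact (hzinj hij).not_lt hj)
  choose g hg1 hg0 hgn using hg
  have hcoeff : ∀ i y, F.coeffAt 0 y (a * (F.mono 0 (g i) * a) * a) =
      f y * (g i y * f y) * f y := by
    intro i y
    simp only [coeffAt_zero_mul, coeffAt_mono, if_true]
    rfl
  refine ⟨fun i => F.mono 0 (g i), z, ‖f x‖ / 2 * (‖f x‖ / 2) * (‖f x‖ / 2), by positivity,
    fun i => (hz i).2, fun i => ?_, fun i j hij => ?_, fun i => ?_⟩
  · calc ‖F.mono 0 (g i) * a‖ ≤ ‖F.mono 0 (g i)‖ * ‖a‖ := norm_mul_le _ _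
      _ ≤ 1 * ‖a‖ := by gcongr; exact (F.norm_mono_le _ _).trans (hgn i)
      _ = ‖a‖ := one_mul _
  · rw [hcoeff, hg0 j (z i) (fun h => h ⟨i, hij, rfl⟩), zero_mul, mul_zero, zero_mul]
  · rw [hcoeff, hg1, one_mul, norm_mul, norm_mul]
    have : ‖f x‖ / 2 ≤ ‖f (z i)‖ := (hz i).1.le
    gcongr

/-- A hypocompact closed ideal is contained in the vanishing ideal of a perfect set and the closure
of an invariant set of recurrent points. -/
theorem le_vanishingIdeal_of_isHypocompact [T2Space X] [LocallyCompactSpace X] {P Y : Set X}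
    (hP : Preperfect P) (hY : ∀ n : ℕ, ∀ x ∈ Y, φ^[n] x ∈ Y)
    (hYrec : Y = closure (Dyn.recurrentPoints φ)) {J : NonUnitalSubalgebra ℂ A}
    (hJ : BanachAlg.IsClosedIdeal J) (hc : BanachAlg.IsHypocompact J) :
    J ≤ F.vanishingIdeal P Y hY := by
  by_contra hle
  obtain ⟨b, hbJ, hbR⟩ := SetLike.not_le_iff_exists.1 hle
  set R := F.vanishingIdeal P Y hY with hR
  have hRi : BanachAlg.IsClosedIdeal R := F.isClosedIdeal_vanishingIdeal P Y hY
  set K : NonUnitalSubalgebra ℂ J := R.comap (NonUnitalSubalgebraClass.subtype J) with hKdef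
  have hK : BanachAlg.IsClosedIdeal K :=
    ⟨hRi.isClosed.preimage continuous_subtype_val,
      fun a x hx => hRi.mul_mem_left a x hx, fun a x hx => hRi.mul_mem_right a x hx⟩
  have hnt : Nontrivial (J ⧸ K.toSubmodule) := by
    refine Submodule.Quotient.nontrivial_iff.2 fun htop => hbR ?_
    exact htop.ge (Submodule.mem_top (x := (⟨b, hbJ⟩ : J)))
  obtain ⟨q, hq0, hqc⟩ := hc K hK hnt
  obtain ⟨⟨a, haJ⟩, rfl⟩ := K.toSubmodule.mkQ_surjective q
  have haR : a ∉ R := fun h => hq0 ((Submodule.Quotient.mk_eq_zero _).2 h)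
  -- Any such sequence is `ε`-separated in `J/K` after multiplication by `a` on both sides, as
  -- detected by the coefficient functionals, which vanish on `R`; compactness of `[a]` forbids
  -- this.
  have key : ∀ (y : ℕ → A), (∀ i, y i ∈ J) → (∀ i, ‖y i‖ ≤ ‖a‖) → ∀ (n : ℕ → ℕ) (z : ℕ → X) (ε : ℝ),
      0 < ε → (∀ i, ∀ r ∈ R, F.coeffAt (n i) (z i) r = 0) →
      (∀ i j, i < j → F.coeffAt (n i) (z i) (a * y j * a) = 0) →
      (∀ i, ε ≤ ‖F.coeffAt (n i) (z i) (a * y i * a)‖) → False := by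
    intro y hyJ hya n z ε hε hRz h0 hge
    obtain ⟨i, j, hij, hlt⟩ := hqc.exists_norm_sub_lt (fun i => ⟨y i, hyJ i⟩) ‖a‖ hya hε
    refine absurd hlt (not_lt.2 ?_)
    set w : J := ⟨a, haJ⟩ * ⟨y i, hyJ i⟩ * ⟨a, haJ⟩ - ⟨a, haJ⟩ * ⟨y j, hyJ j⟩ * ⟨a, haJ⟩ with hw
    have h1 := BanachAlg.norm_apply_le_norm_mkQ K
      (LinearMap.mkContinuous
        { toFun := fun x : J => F.coeffAt (n i) (z i) (x : A)
          map_add' := fun x x' => map_add (F.coeffAt (n i) (z i)) (x : A) x'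
          map_smul' := fun c x => map_smul (F.coeffAt (n i) (z i)) c (x : A) } 1
        fun x => by rw [one_mul]; exact F.norm_coeffAt_apply_le _ _ _)
      (fun x => F.norm_coeffAt_apply_le _ _ _) (fun x hx => hRz i _ hx) w
    refine le_trans ?_ h1
    have h2 : F.coeffAt (n i) (z i) (w : A) = F.coeffAt (n i) (z i) (a * y i * a) := by
      have : (w : A) = a * y i * a - a * y j * a := rfl
      rw [this, map_sub, h0 i j hij, sub_zero]
    change ε ≤ ‖F.coeffAt (n i) (z i) (w : A)‖
    rw [h2]
    exact hge i
  by_cases hY0 : ∃ n, ∃ x ∈ Y, F.coeffAt n x a ≠ 0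
  · classical
    set n := Nat.find hY0
    obtain ⟨x, hxY, hax⟩ := Nat.find_spec hY0
    have hmin : ∀ k < n, ∀ x ∈ Y, F.coeffAt k x a = 0 := by
      intro k hk x hx
      by_contra h
      exact Nat.find_min hY0 hk ⟨x, hx, h⟩
    rw [hYrec] at hxY
    obtain ⟨x', hx'ne, hx'⟩ := mem_closure_iff.1 hxY {x | F.coeff n a x ≠ 0}
      (isOpen_ne_fun (F.coeff n a).continuous continuous_const) hax
    have hx'Y : x' ∈ Y := hYrec ▸ subset_closure hx'
    obtain ⟨b, c, N, ε, hε, hn, h0, hge⟩ := F.exists_separated_of_recurrent hY hx'Y hx' hmin hx'ne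
    exact key (fun i => b i * a * c i)
      (fun i => hJ.mul_mem_right _ _ (hJ.mul_mem_left _ _ haJ)) hn N (fun _ => x') ε hε
      (fun i r hr => hr.2 _ _ hx'Y) h0 hge
  · push Not at hY0
    have : ∃ x ∈ P, F.coeffAt 0 x a ≠ 0 := by
      by_contra! h
      exact haR ⟨h, hY0⟩
    obtain ⟨x, hxP, hax⟩ := this
    obtain ⟨b, z, ε, hε, hz, hn, h0, hge⟩ := F.exists_separated_of_preperfect hP hxP hax
    exact key (fun i => b i * a) (fun i => hJ.mul_mem_left _ _ haJ) hn (fun _ => 0) z ε hε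
      (fun i r hr => hr.1 _ (hz i)) h0 hge

/-- A subspace that absorbs `mono n f`, `n ≥ 1`, whenever `mono n f * a * mono n f` lies in it for
all `a`, contains all `mono n f` with `f` vanishing on the non-wandering sets `X_γ`. -/
theorem mono_mem_of_absorbing [T2Space X] [LocallyCompactSpace X] (J : Submodule ℂ A)
    (hJ : IsClosed (J : Set A)) (γ₀ : Ordinal.{u})
    (habs : ∀ n, 1 ≤ n → ∀ f : C₀(X, ℂ), (∀ x ∈ Dyn.iterNonWandering φ γ₀, f x = 0) →
      (∀ a, F.mono n f * a * F.mono n f ∈ J) → F.mono n f ∈ J)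
    {n : ℕ} (hn : 1 ≤ n) {f : C₀(X, ℂ)} (hf : ∀ x ∈ Dyn.iterNonWandering φ γ₀, f x = 0) :
    F.mono n f ∈ J := by
  -- All degrees `n ≥ 1` are required at once, since `U^n f · U^m g · U^n f` has degree `2n + m`.
  set S : Submodule ℂ C₀(X, ℂ) :=
    { carrier := {f | (∀ x ∈ Dyn.iterNonWandering φ γ₀, f x = 0) ∧ ∀ n, 1 ≤ n → F.mono n f ∈ J}
      zero_mem' := ⟨fun _ _ => rfl, fun n _ => by rw [map_zero]; exact J.zero_mem⟩
      add_mem' := fun {f g} hf hg => ⟨fun x hx => by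
          rw [ZeroAtInftyContinuousMap.add_apply, hf.1 x hx, hg.1 x hx, add_zero],
        fun n hn => by rw [map_add]; exact J.add_mem (hf.2 n hn) (hg.2 n hn)⟩
      smul_mem' := fun c f hf => ⟨fun x hx => by
          rw [ZeroAtInftyContinuousMap.smul_apply, hf.1 x hx, smul_zero],
        fun n hn => by rw [map_smul]; exact J.smul_mem c (hf.2 n hn)⟩ } with hS
  have hScl : IsClosed (S : Set C₀(X, ℂ)) := by
    have : (S : Set C₀(X, ℂ)) = (⋂ x ∈ Dyn.iterNonWandering φ γ₀, {f | f x = 0}) ∩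
        ⋂ n, ⋂ _ : 1 ≤ n, F.mono n ⁻¹' (J : Set A) := by
      ext f
      simp [hS]
    rw [this]
    refine (isClosed_biInter fun x _ => ?_).inter
      (isClosed_iInter fun n => isClosed_iInter fun _ => hJ.preimage (F.continuous_mono n))
    exact ZeroAtInftyContinuousMap.isClosed_setOf_apply_eq_zero x
  suffices h : ∀ γ ≤ γ₀, ZeroAtInftyContinuousMap.cosupport S ⊆ Dyn.iterNonWandering φ γ from
    (ZeroAtInftyContinuousMap.mem_of_eq_zero_on_cosupport hScl
      fun x hx => hf x (h γ₀ le_rfl hx)).2 n hn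
  intro γ
  induction γ using Ordinal.limitRecOn with
  | zero => simp [Dyn.iterNonWandering_zero]
  | limit γ hγ ih =>
    intro hle
    rw [Dyn.iterNonWandering_limit φ γ hγ]
    exact fun x hx => Set.mem_iInter₂.2 fun β hβ => ih β hβ (hβ.le.trans hle) hx
  | add_one γ ih =>
    intro hle x hxS
    have hsub := ih ((Order.le_succ γ).trans hle)
    by_contra hx
    have hx' := hx
    rw [Dyn.iterNonWandering_succ] at hx'
    have : ∃ V : Set X, IsOpen V ∧ x ∈ V ∧ Dyn.IsWandering φ (V ∩ Dyn.iterNonWandering φ γ) := by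
      by_contra! h
      exact hx' ⟨hsub hxS, h⟩
    obtain ⟨V, hV, hxV, hw⟩ := this
    rw [Dyn.isWandering_iff] at hw
    have hcl := Dyn.isClosed_iterNonWandering φ (γ + 1)
    refine ZeroAtInftyContinuousMap.notMem_cosupport.2
      ⟨V ∩ (Dyn.iterNonWandering φ (γ + 1))ᶜ, hV.inter hcl.isOpen_compl, ⟨hxV, hx⟩, ?_⟩ hxS
    intro f hf
    have hf0 : ∀ y ∈ Dyn.iterNonWandering φ γ₀, f y = 0 := fun y hy =>
      hf y fun h => h.2 (Dyn.iterNonWandering_antitone φ hle hy)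
    refine ⟨hf0, fun n hn => habs n hn f hf0 fun a => ?_⟩
    refine F.apply_mem_of_forall_mono
      (LinearMap.mulRight ℂ (F.mono n f) ∘ₗ LinearMap.mulLeft ℂ (F.mono n f))
      ((continuous_const.mul continuous_id).mul continuous_const) J hJ (fun m g => ?_) a
    change F.mono n f * F.mono m g * F.mono n f ∈ J
    rw [F.mono_mul, F.mono_mul]
    -- By induction the cosupport lies in `X_γ`. A point of it in `V` leaves `V` after `m + n ≥ 1`
    -- steps, so one of the two factors coming from `f` vanishes there.
    have hmem : alpha φ n (alpha φ m f * g) * f ∈ S := by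
      refine ZeroAtInftyContinuousMap.mem_of_eq_zero_on_cosupport hScl fun y hy => ?_
      have e : (alpha φ n (alpha φ m f * g) * f) y = f (φ^[m] (φ^[n] y)) * g (φ^[n] y) * f y := rfl
      rw [e]
      by_cases hyV : y ∈ V
      · have hyγ := hsub hy
        have h1 : φ^[m] (φ^[n] y) ∉ V := by
          intro h
          refine hw (m + n) (by omega) y ⟨hyV, hyγ⟩ ⟨?_, Dyn.iterate_mem_iterNonWandering φ γ _ hyγ⟩
          rwa [Function.iterate_add_apply]
        rw [hf _ fun h => h1 h.1, zero_mul, zero_mul]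
      · rw [hf y fun h => hyV h.1, mul_zero]
    exact hmem.2 _ (by omega)

/-- A closed subspace `J` containing `mono n f`, `n ≥ 1`, for `f` vanishing on `Y`, that absorbs
`mono 0 f` whenever the compression by it has rank one modulo `J`, contains `mono 0 f` for all `f`
vanishing on `Y` and on the perfect kernel. -/
theorem mono_zero_mem_of_absorbing [T2Space X] [LocallyCompactSpace X] (J : Submodule ℂ A)
    (hJ : IsClosed (J : Set A)) {Y P : Set X} (hYc : IsClosed Y) (hPc : IsClosed P)
    (hP : ∀ Q : Set X, Perfect Q → Q ⊆ P)
    (hJ1 : ∀ n, 1 ≤ n → ∀ f : C₀(X, ℂ), (∀ x ∈ Y, f x = 0) → F.mono n f ∈ J)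
    (habs : ∀ f g : C₀(X, ℂ), (∀ x ∈ Y ∪ P, f x = 0) → (∀ x ∈ Y ∪ P, g x = 0) →
      (∀ a, ∃ z : ℂ, F.mono 0 f * a * F.mono 0 f - z • F.mono 0 g ∈ J) → F.mono 0 f ∈ J)
    {f : C₀(X, ℂ)} (hf : ∀ x ∈ Y ∪ P, f x = 0) : F.mono 0 f ∈ J := by
  set S : Submodule ℂ C₀(X, ℂ) :=
    { carrier := {f | (∀ x ∈ Y ∪ P, f x = 0) ∧ F.mono 0 f ∈ J}
      zero_mem' := ⟨fun _ _ => rfl, by rw [map_zero]; exact J.zero_mem⟩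
      add_mem' := fun {f g} hf hg => ⟨fun x hx => by
          rw [ZeroAtInftyContinuousMap.add_apply, hf.1 x hx, hg.1 x hx, add_zero],
        by rw [map_add]; exact J.add_mem hf.2 hg.2⟩
      smul_mem' := fun c f hf => ⟨fun x hx => by
          rw [ZeroAtInftyContinuousMap.smul_apply, hf.1 x hx, smul_zero],
        by rw [map_smul]; exact J.smul_mem c hf.2⟩ } with hS
  have hScl : IsClosed (S : Set C₀(X, ℂ)) := by
    have : (S : Set C₀(X, ℂ)) = (⋂ x ∈ Y ∪ P, {f | f x = 0}) ∩ F.mono 0 ⁻¹' (J : Set A) := by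
      ext f
      simp [hS]
    rw [this]
    refine (isClosed_biInter fun x _ => ?_).inter (hJ.preimage (F.continuous_mono 0))
    exact ZeroAtInftyContinuousMap.isClosed_setOf_apply_eq_zero x
  set Z := ZeroAtInftyContinuousMap.cosupport S
  suffices h : Z ⊆ Y ∪ P from
    (ZeroAtInftyContinuousMap.mem_of_eq_zero_on_cosupport hScl fun x hx => hf x (h hx)).2
  by_contra hne
  -- The closure of a preperfect set is perfect, hence inside `P`; so the part of the cosupport
  -- outside `Y ∪ P`, if nonempty, has an isolated point.
  have hnp : ¬ Preperfect (Z \ (Y ∪ P)) := by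
    intro hp
    obtain ⟨x, hxZ, hx⟩ := Set.not_subset.1 hne
    exact hx (Or.inr (hP _ hp.perfect_closure (subset_closure ⟨hxZ, hx⟩)))
  rw [preperfect_iff_nhds] at hnp
  push Not at hnp
  obtain ⟨x, ⟨hxZ, hx⟩, U, hU, hiso⟩ := hnp
  set V : Set X := interior U ∩ (Y ∪ P)ᶜ with hVdef
  have hV : IsOpen V := isOpen_interior.inter (hYc.union hPc).isOpen_compl
  have hxV : x ∈ V := ⟨mem_interior_iff_mem_nhds.2 hU, hx⟩
  have hVZ : ∀ y ∈ V, y ∈ Z → y = x := fun y hy hyZ =>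
    hiso y ⟨interior_subset hy.1, hyZ, hy.2⟩
  have hvan : ∀ g : C₀(X, ℂ), (∀ y ∉ V, g y = 0) → ∀ y ∈ Y ∪ P, g y = 0 :=
    fun g hg y hy => hg y fun h => h.2 hy
  obtain ⟨χ, hχx, hχ, -⟩ := ZeroAtInftyContinuousMap.exists_apply_eq_one hV hxV
  refine ZeroAtInftyContinuousMap.notMem_cosupport.2 ⟨V, hV, hxV, fun f hf => ?_⟩ hxZ
  -- Since `V` meets the cosupport only at `x`, modulo `J` only the value of `f E_0(a) f` at `x`
  -- survives, carried by `χ` with `χ x = 1`; positive degrees are already in `J`.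
  refine ⟨hvan f hf, habs f χ (hvan f hf) (hvan χ hχ) fun a => ⟨F.coeffAt 0 x a * f x ^ 2, ?_⟩⟩
  have hT : Continuous (LinearMap.mulRight ℂ (F.mono 0 f) ∘ₗ LinearMap.mulLeft ℂ (F.mono 0 f) -
      ((F.coeffAt 0 x).toLinearMap).smulRight (f x ^ 2 • F.mono 0 χ)) :=
    ((continuous_const.mul continuous_id).mul continuous_const).sub
      ((F.coeffAt 0 x).continuous.smul continuous_const)
  have := F.apply_mem_of_forall_mono _ hT J hJ (fun m g => ?_) a
  · rw [mul_smul]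
    exact this
  change F.mono 0 f * F.mono m g * F.mono 0 f -
    F.coeffAt 0 x (F.mono m g) • f x ^ 2 • F.mono 0 χ ∈ J
  rw [F.mono_mul, F.mono_mul, coeffAt_mono]
  rcases Nat.eq_zero_or_pos m with rfl | hm
  · rw [if_pos rfl, smul_smul, ← map_smul]
    change F.mono 0 _ - F.mono 0 _ ∈ J
    rw [← map_sub]
    suffices h : _ ∈ S from h.2
    refine ZeroAtInftyContinuousMap.mem_of_eq_zero_on_cosupport hScl fun y hy => ?_
    change f y * g y * f y - g x * f x ^ 2 * χ y = 0
    by_cases hyV : y ∈ V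
    · rw [hVZ y hyV hy, hχx]
      ring
    · rw [hf y hyV, hχ y hyV]
      ring
  · rw [if_neg hm.ne, zero_smul, sub_zero]
    refine hJ1 _ (by omega) _ fun y hy => ?_
    change f (φ^[m] y) * g y * f y = 0
    rw [hvan f hf y (Or.inl hy), mul_zero]

/-- If `R/J` had no nonzero compact element, every element whose two-sided multiplication has rank
at most one modulo `J` would lie in `J`. The two absorption lemmas then put all monomials of `R` in
`J`, and synthesis gives `J = R`. -/
theorem isHypocompact_vanishingIdeal [T2Space X] [LocallyCompactSpace X] {P : Set X}
    (hPc : IsClosed P) (hP : ∀ Q : Set X, Perfect Q → Q ⊆ P) (γ₀ : Ordinal.{u})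
    (hY : ∀ n : ℕ, ∀ x ∈ Dyn.iterNonWandering φ γ₀, φ^[n] x ∈ Dyn.iterNonWandering φ γ₀) :
    BanachAlg.IsHypocompact (F.vanishingIdeal P (Dyn.iterNonWandering φ γ₀) hY) := by
  set Y := Dyn.iterNonWandering φ γ₀
  set R := F.vanishingIdeal P Y hY with hR
  have hRi : BanachAlg.IsClosedIdeal R := F.isClosedIdeal_vanishingIdeal P Y hY
  intro J hJ hnt
  by_contra! hcon
  -- `J` is an ideal of `R` only, so its image in `A` is used merely as a closed subspace.
  set J₁ : Submodule ℂ A := J.toSubmodule.map R.toSubmodule.subtype with hJ₁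
  have hJ₁c : IsClosed (J₁ : Set A) :=
    hRi.isClosed.isClosedEmbedding_subtypeVal.isClosedMap _ hJ.isClosed
  have habs : ∀ a ∈ R, ∀ c ∈ R, (∀ x, ∃ z : ℂ, a * x * a - z • c ∈ J₁) → a ∈ J₁ := by
    intro a ha c hc h
    have h1 : BanachAlg.IsCompactInQuotient J hJ (J.toSubmodule.mkQ ⟨a, ha⟩) := by
      refine BanachAlg.isCompactInQuotient_of_rank_le_one J hJ ⟨a, ha⟩ ⟨c, hc⟩ fun x => ?_
      obtain ⟨z, w, hw, hwz⟩ := h x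
      refine ⟨z, ?_⟩
      have : (⟨a, ha⟩ * x * ⟨a, ha⟩ - z • ⟨c, hc⟩ : R) = w := Subtype.ext hwz.symm
      rw [this]
      exact hw
    have h2 : J.toSubmodule.mkQ ⟨a, ha⟩ = 0 := by
      by_contra hne
      exact hcon _ hne h1
    exact ⟨⟨a, ha⟩, (Submodule.Quotient.mk_eq_zero _).1 h2, rfl⟩
  have hpos : ∀ n, 1 ≤ n → ∀ f : C₀(X, ℂ), (∀ x ∈ Y, f x = 0) → F.mono n f ∈ J₁ := by
    intro n hn f hf
    refine F.mono_mem_of_absorbing J₁ hJ₁c γ₀ (fun n hn f hf h => ?_) hn hf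
    refine habs _ (F.mono_mem_vanishingIdeal hY (by omega) hf) 0 R.zero_mem fun x => ⟨0, ?_⟩
    rw [smul_zero, sub_zero]
    exact h x
  have hzero : ∀ f : C₀(X, ℂ), (∀ x ∈ Y ∪ P, f x = 0) → F.mono 0 f ∈ J₁ := by
    intro f hf
    refine F.mono_zero_mem_of_absorbing J₁ hJ₁c (Dyn.isClosed_iterNonWandering φ γ₀) hPc hP hpos
      (fun f g hf hg h => ?_) hf
    exact habs _ (F.mono_mem_vanishingIdeal hY (fun _ x hx => hf x (Or.inr hx))
      fun x hx => hf x (Or.inl hx)) _ (F.mono_mem_vanishingIdeal hY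
        (fun _ x hx => hg x (Or.inr hx)) fun x hx => hg x (Or.inl hx)) h
  refine Submodule.Quotient.nontrivial_iff.1 hnt (eq_top_iff.2 ?_)
  rintro ⟨a, ha⟩ -
  have haJ : a ∈ J₁ := by
    refine F.mem_of_forall_mono_coeff_mem J₁ hJ₁c a fun n => ?_
    rcases Nat.eq_zero_or_pos n with rfl | hn
    · exact hzero _ fun x hx => hx.elim (ha.2 0 x) (ha.1 x)
    · exact hpos n hn _ fun x hx => ha.2 n x hx
  obtain ⟨w, hw, hwa⟩ := haJ
  have : w = ⟨a, ha⟩ := Subtype.ext hwa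
  exact this ▸ hw

end FourierSystem

variable {X : Type u} [TopologicalSpace X]
variable {H₀ : Type v} [NormedAddCommGroup H₀] [InnerProductSpace ℂ H₀] [CompleteSpace H₀]

/-- The Fourier system of the semicrossed product. -/
def fourierSystem (φ : X ≃ₜ X) (ρ : C₀(X, ℂ) →⋆ₙₐ[ℂ] (H₀ →L[ℂ] H₀)) (hρ : Function.Injective ρ) :
    FourierSystem φ (semicrossedProduct φ ρ) where
  mono n := (monomialL φ ρ n).toLinearMap
  norm_mono_le := norm_monomialL_apply_le φ ρ
  mono_mul := monomialL_mul φ ρ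
  coeff n := (coeffL φ ρ hρ n).toLinearMap
  norm_coeff_le := norm_coeffL_apply_le φ ρ hρ
  coeff_mono := coeffL_monomialL φ ρ hρ
  mem_of_forall_mono_coeff_mem S hS _ h := mem_of_forall_monomialL_coeffL_mem φ ρ hρ S hS h

end SemiCrossed

end

/-! ### The hypocompact radical of the semicrossed product. -/

theorem theorem2p5 {X : Type u} [TopologicalSpace X] [LocallyCompactSpace X]
    [TopologicalSpace.MetrizableSpace X] (φ : X ≃ₜ X)
    {H₀ : Type v} [NormedAddCommGroup H₀] [InnerProductSpace ℂ H₀] [CompleteSpace H₀]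
    (ρ : C₀(X, ℂ) →⋆ₙₐ[ℂ] (H₀ →L[ℂ] H₀)) (hρ : Function.Injective ρ) :
    (∃ R : NonUnitalSubalgebra ℂ (SemiCrossed.semicrossedProduct φ ρ),
      BanachAlg.IsHypocompactRadical R ∧
      (R : Set (SemiCrossed.semicrossedProduct φ ρ)) =
        {A | (∀ x ∈ CantorBendixson.perfectKernel (Set.univ : Set X),
                SemiCrossed.fourierCoeff φ ρ hρ 0 A x = 0) ∧
             ∀ n : ℕ, ∀ x ∈ Dyn.iterNonWandering φ (Dyn.depth φ),
                SemiCrossed.fourierCoeff φ ρ hρ n A x = 0}) ∧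
    Dyn.iterNonWandering φ (Dyn.depth φ) = closure (Dyn.recurrentPoints φ) := by
  have hY := Dyn.iterNonWandering_depth_eq_closure φ
  have hperf := CantorBendixson.perfect_perfectKernel (isClosed_univ (X := X))
  have hinv : ∀ n : ℕ, ∀ x ∈ Dyn.iterNonWandering φ (Dyn.depth φ),
      φ^[n] x ∈ Dyn.iterNonWandering φ (Dyn.depth φ) := fun n x hx =>
    Dyn.iterate_mem_iterNonWandering φ _ n hx
  set F := SemiCrossed.fourierSystem φ ρ hρ
  refine ⟨⟨F.vanishingIdeal (CantorBendixson.perfectKernel Set.univ) _ hinv,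
    ⟨⟨F.isClosedIdeal_vanishingIdeal _ _ hinv, ?_⟩, ?_⟩, rfl⟩, hY⟩
  · exact F.isHypocompact_vanishingIdeal hperf.closed
      (fun Q hQ => hQ.subset_perfectKernel (Set.subset_univ Q)) _ hinv
  · exact fun J hJ => F.le_vanishingIdeal_of_isHypocompact hperf.acc hinv hY hJ.1 hJ.2
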